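/- A time series is a finite nonempty sequence of real numbers $x=[x_0,\dots,x_{N-1}]$. A sample $x_i$ is a local minimum if it is strictly smaller than each of its existing neighbours $x_{i-1},x_{i+1}$ (so an endpoint is compared with its only neighbour, and the sample of a one-element series is a local minimum); it is a local maximum if $0<i<N-1$ and it is strictly larger than both neighbours. The critical series $x^c$ is obtained from $x$ by removing all samples that are neither local minima nor local maxima. We assume that $x$ has no flat extremum: no maximal run of two or more equal consecutive samples has all samples adjacent to the run strictly larger, and no such run has an adjacent sample on each side with both strictly smaller. (This holds for instance if consecutive samples are always different.) An alignment $A=(M,R_x,R_y)$ of $x$ and $y$ consists of a set $M$ of matched pairs $(x^c_i,y^c_j)$ that is order preserving ($i_1<i_2$ implies $j_1<j_2$ for any two matched pairs), and sets $R_x$, $R_y$ of pairs of consecutive elements $(x^c_k,x^c_{k+1})$, respectively $(y^c_k,y^c_{k+1})$, such that every element of $x^c$ (as indexed) occurs in exactly one pair of $M$ or $R_x$ and not in both, and every element of $y^c$ in exactly one pair of $M$ or $R_y$ and not in both. Its cost is $$C(A)=\sum_{(x^c_i,y^c_j)\in M}|x^c_i-y^c_j|+\sum_{(x^c_k,x^c_{k+1})\in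 R_x}|x^c_k-x^c_{k+1}|+\sum_{(y^c_k,y^c_{k+1})\in R_y}|y^c_k-y^c_{k+1}|,$$ and $\mathrm{DOPE}(x,y)$ is the minimum of $C(A)$ over all alignments $A$. Let $\mathrm{Dgm}(x)$ be the degree-zero persistence diagram of the sublevelset filtration of the piecewise linear extension of $x^c$, with pairs (birth, death) given by the elder rule: when path components of the sublevelsets merge at height $d$, the component with the lowest minimum survives, and each of the others, with lowest value $b$, yields the point $(b,d)$ (ties between minima of equal height are broken by time order, and this does not affect the diagram); the component that never dies yields the point $(\min x^c,\infty)$. For $q\in[1,\infty]$, let $d^{1}_{\mathcal W,q}$ be the $1$-Wasserstein distance between diagrams: the infimum, over all perfect matchings between the two diagrams, each augmented by the points $(b,b)$ of the diagonal with infinite multiplicity, of the sum of the $\ell^q$ distances between matched points, where points at infinity are matched with points at infinity at the cost of the difference of their births. Proposition (Informativity). For all time series $x,y$ without flat extrema and every $q\in[1,\infty]$, $$d^{1}_{\mathcal W,q}(\mathrm{Dgm}(x),\mathrm{Dgm}(y))\le \mathrm{DOPE}(x,y).$$ -/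

import Mathlib

open scoped ENNReal

noncomputable section

namespace TimeSeries

/-! A one-dimensional time series is a finite list of real numbers. -/

/-! ### Critical points -/

/-- Two sample indices are adjacent in time. -/
def Adjacent {n : ℕ} (i j : Fin n) : Prop :=
  i.val + 1 = j.val ∨ j.val + 1 = i.val

/-- Local minimum: strictly below every adjacent sample. An interior sample is compared with both
neighbours and an endpoint with its only neighbour; the sample of a one-element series, which has no
neighbour, is a local minimum. -/
def IsLocMin (x : List ℝ) (i : Fin x.length) : Prop :=
  ∀ j : Fin x.length, Adjacent i j → x.get i < x.get j

/-- Local maximum: an interior sample strictly above both neighbours. Endpoints are never local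
maxima. -/
def IsLocMax (x : List ℝ) (i : Fin x.length) : Prop :=
  0 < i.val ∧ i.val + 1 < x.length ∧ ∀ j : Fin x.length, Adjacent i j → x.get j < x.get i

def IsCritical (x : List ℝ) (i : Fin x.length) : Prop :=
  IsLocMin x i ∨ IsLocMax x i

open Classical in
/-- The critical time series `x^c`: all noncritical samples are removed, in the same order. -/
def criticalSeries (x : List ℝ) : List ℝ :=
  ((List.finRange x.length).filter (fun i => decide (IsCritical x i))).map x.get

/-- No run `x_i = x_{i+1} = ... = x_j` of two or more equal samples is a flat local minimum (all
samples next to the run, on either side, are strictly larger) or a flat interior local maximum (there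
is a sample next to the run on each side, and both are strictly smaller). This holds in particular
if consecutive samples are always different. -/
def NoFlatExtremum (x : List ℝ) : Prop :=
  ∀ i j : Fin x.length, i < j →
    (∀ k : Fin x.length, i ≤ k → k ≤ j → x.get k = x.get i) →
    ¬ ((∀ k : Fin x.length, k.val + 1 = i.val → x.get i < x.get k) ∧
        (∀ l : Fin x.length, j.val + 1 = l.val → x.get j < x.get l)) ∧
    ¬ ∃ k l : Fin x.length, k.val + 1 = i.val ∧ j.val + 1 = l.val ∧
        x.get k < x.get i ∧ x.get l < x.get j

/-! ### The DOPE distance -/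

/-- An alignment between two (critical) series `a`, `b`: matched pairs, and removed pairs of
consecutive elements of `a` and of `b`. Elements are addressed by their indices. -/
structure Alignment (a b : List ℝ) where
  /-- matched pairs -/
  M : Finset (Fin a.length × Fin b.length)
  /-- removed pairs of `a` -/
  Ra : Finset (Fin a.length × Fin a.length)
  /-- removed pairs of `b` -/
  Rb : Finset (Fin b.length × Fin b.length)
  ordered : ∀ p ∈ M, ∀ q ∈ M, p.1 < q.1 → p.2 < q.2
  consecutive_left : ∀ p ∈ Ra, p.1.val + 1 = p.2.val
  consecutive_right : ∀ p ∈ Rb, p.1.val + 1 = p.2.val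
  /-- every element of `a` appears in exactly one pair of `M` or `Ra`, and not in both -/
  exactly_one_left : ∀ i : Fin a.length,
    (M.filter (fun p => p.1 = i)).card + (Ra.filter (fun p => p.1 = i ∨ p.2 = i)).card = 1
  /-- every element of `b` appears in exactly one pair of `M` or `Rb`, and not in both -/
  exactly_one_right : ∀ j : Fin b.length,
    (M.filter (fun p => p.2 = j)).card + (Rb.filter (fun p => p.1 = j ∨ p.2 = j)).card = 1
  card_left : M.card =
    (Finset.univ.filter (fun i : Fin a.length => ∀ p ∈ Ra, p.1 ≠ i ∧ p.2 ≠ i)).card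
  card_right : M.card =
    (Finset.univ.filter (fun j : Fin b.length => ∀ p ∈ Rb, p.1 ≠ j ∧ p.2 ≠ j)).card

/-- The cost of an alignment. -/
def Alignment.cost {a b : List ℝ} (A : Alignment a b) : ℝ :=
  ∑ p ∈ A.M, |a.get p.1 - b.get p.2| + ∑ p ∈ A.Ra, |a.get p.1 - a.get p.2| +
    ∑ p ∈ A.Rb, |b.get p.1 - b.get p.2|

/-- The DOPE distance: the minimal cost of an alignment between the critical series (there are only
finitely many alignments). -/
def dope (x y : List ℝ) : ℝ :=
  sInf (Set.range (fun A : Alignment (criticalSeries x) (criticalSeries y) => A.cost))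

/-! ### Sublevelset persistence -/

/-- Piecewise linear extension of the series `s` (sample `k` sits at time `k`); it is used only on
`[0, s.length - 1]`. -/
def plExtension (s : List ℝ) (u : ℝ) : ℝ :=
  s.getD ⌊u⌋₊ 0 + (u - ⌊u⌋₊) * (s.getD (⌊u⌋₊ + 1) 0 - s.getD ⌊u⌋₊ 0)

/-- Sublevelset at height `t` of the piecewise linear extension. -/
def sublevel (s : List ℝ) (t : ℝ) : Set ℝ :=
  {u | 0 ≤ u ∧ u ≤ (s.length : ℝ) - 1 ∧ plExtension s u ≤ t}

/-- Samples `i`, `j` lie in the same path component of the sublevelset at height `t`. -/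
def SameComponent (s : List ℝ) (t : ℝ) (i j : Fin s.length) : Prop :=
  JoinedIn (sublevel s t) (i.val : ℝ) (j.val : ℝ)

/-- Sample `j` enters the filtration before sample `i`. Samples of equal height are ordered by time;
the persistence diagram does not depend on how such ties are broken. -/
def Older (s : List ℝ) (j i : Fin s.length) : Prop :=
  s.get j < s.get i ∨ (s.get j = s.get i ∧ j < i)

/-- Elder rule: the component represented by sample `i` dies at the first height at which it has
been merged with a component that contains an older sample. (A sample that starts no component of
its own dies at its own height.) -/
def death (s : List ℝ) (i : Fin s.length) : ℝ :=
  sInf {t : ℝ | ∃ j : Fin s.length, Older s j i ∧ SameComponent s t i j}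

/-- A persistence diagram: the multiset of its finite points `(birth, death)`, and the multiset of
births of the components that never die, i.e. of the points `(birth, ∞)`. -/
structure Diagram where
  finite : Multiset (ℝ × ℝ)
  essential : Multiset ℝ

open Classical in
/-- The persistence diagram, in degree zero, of the sublevelset filtration of the piecewise linear
extension of `s`. -/
def diagram (s : List ℝ) : Diagram where
  finite :=
    ((Finset.univ.filter
      (fun i : Fin s.length => (∃ j, Older s j i) ∧ s.get i < death s i)).val).map
        (fun i => (s.get i, death s i))
  essential :=
    ((Finset.univ.filter (fun i : Fin s.length => ¬ ∃ j, Older s j i)).val).map s.get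

/-- A perfect matching between two diagrams to which diagonal points have been added. `pairs` lists
the matched pairs in which diagonal points may take part; all the other (infinitely many) diagonal
points are matched with themselves, at no cost. Points at infinity are matched among themselves. -/
structure DiagramMatching (D E : Diagram) where
  pairs : Multiset ((ℝ × ℝ) × (ℝ × ℝ))
  /-- diagonal points added to `D` -/
  diagLeft : Multiset (ℝ × ℝ)
  /-- diagonal points added to `E` -/
  diagRight : Multiset (ℝ × ℝ)
  diagLeft_mem : ∀ p ∈ diagLeft, p.1 = p.2
  diagRight_mem : ∀ p ∈ diagRight, p.1 = p.2
  pairs_fst : pairs.map Prod.fst = D.finite + diagLeft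
  pairs_snd : pairs.map Prod.snd = E.finite + diagRight
  essentialPairs : Multiset (ℝ × ℝ)
  essential_fst : essentialPairs.map Prod.fst = D.essential
  essential_snd : essentialPairs.map Prod.snd = E.essential

/-- Total length of a matching, lengths in the plane being measured in the `ℓ^q` norm. -/
def DiagramMatching.cost (q : ℝ≥0∞) [Fact (1 ≤ q)] {D E : Diagram} (γ : DiagramMatching D E) :
    ℝ≥0∞ :=
  (γ.pairs.map (fun p => edist (WithLp.toLp q p.1) (WithLp.toLp q p.2))).sum +
    (γ.essentialPairs.map (fun p => edist p.1 p.2)).sum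

/-- The 1-Wasserstein distance between diagrams, with the `ℓ^q` norm as the norm of the plane. -/
def wasserstein1 (q : ℝ≥0∞) [Fact (1 ≤ q)] (D E : Diagram) : ℝ≥0∞ :=
  ⨅ γ : DiagramMatching D E, γ.cost q

end TimeSeries

end

noncomputable section

namespace TimeSeries

/-! ### Matchings of bounded cost -/

/-! It suffices to bound the distance by the cost of each alignment, and to use the `ℓ¹` norm, which
dominates every `ℓ^q`. Removing the pairs of an alignment from the two critical series leaves two
series of equal length. Matchings compose (`Close.trans`), so the effect of removing pairs and that
of changing the matched values can be bounded separately.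

Diagrams are computed through ranks. The number of points with birth at most `t` and death above
`t'` is the number of components at height `t'` that meet the sublevel at `t` (`countP_diagram`),
and such counts determine a multiset of points above the diagonal (`eq_of_countP_quadrant_eq`).
Hence two reductions can be checked by local counting: dropping a sample that is not a strict
extremum keeps the diagram (`Drops.diagram_eq`), and cancelling a suitable adjacent minimum `u` and
maximum `v` deletes the point `(u, v)` (`Cancels.diagram_eq`).

Changing values: if two series of equal length are ordered alike, that is, if their pairs of entries
form a chain in the product order, then each reduction applies to both at once. Every sample is used
at most once, so the total cost is at most the sum of the sample differences (`close_of_chain`). A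
general change moves one sample at a time, stopping at the values of the others (`close_move_one`).

Removing pairs: a pair `x, y` between neighbours `p, r` can be removed at cost `|x - y|` if some `v`
lies both between `x` and `y` and between `p` and `r`: both samples are moved to `v` and dropped
(`close_collapse`). The critical series alternates, and in an alternating run of removed pairs the
collapses can be ordered so that such a `v` always exists (`Wave.collapse`). -/

/-- The `ℓ¹` distance of two points of the plane. -/
def taxi (z : (ℝ × ℝ) × (ℝ × ℝ)) : ℝ := |z.1.1 - z.2.1| + |z.1.2 - z.2.2|

lemma taxi_self (p : ℝ × ℝ) : taxi (p, p) = 0 := by simp [taxi]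

lemma taxi_triangle (a b c : ℝ × ℝ) : taxi (a, c) ≤ taxi (a, b) + taxi (b, c) := by
  have h1 := abs_sub_le a.1 b.1 c.1
  have h2 := abs_sub_le a.2 b.2 c.2
  simp only [taxi]; linarith

/-- There is a matching of `ℓ¹` cost at most `c` between `D` and `E`, where the points on the
diagonal taking part in the matching are ignored. -/
def Close (c : ℝ) (D E : Diagram) : Prop :=
  ∃ (P : Multiset ((ℝ × ℝ) × (ℝ × ℝ))) (Q : Multiset (ℝ × ℝ)),
    (P.map Prod.fst).filter (fun p => p.1 ≠ p.2) = D.finite ∧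
    (P.map Prod.snd).filter (fun p => p.1 ≠ p.2) = E.finite ∧
    Q.map Prod.fst = D.essential ∧ Q.map Prod.snd = E.essential ∧
    (P.map taxi).sum + (Q.map (fun z => |z.1 - z.2|)).sum ≤ c

/-- Two relations, as multisets of pairs, with the same middle part can be glued. -/
lemma exists_glue {α β γ : Type*} (P : Multiset (α × β)) :
    ∀ Q : Multiset (β × γ), P.map Prod.snd = Q.map Prod.fst →
      ∃ R : Multiset (α × β × γ), R.map (fun r => (r.1, r.2.1)) = P ∧ R.map Prod.snd = Q := by
  induction P using Multiset.induction_on with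
  | empty =>
    intro Q h
    refine ⟨0, rfl, ?_⟩
    have hQ : Q = 0 := by simpa using h
    simp [hQ]
  | cons p P ih =>
    intro Q h
    have hm : p.2 ∈ Q.map Prod.fst := by rw [← h]; simp
    obtain ⟨q, hq, hqp⟩ := Multiset.mem_map.1 hm
    obtain ⟨Q', rfl⟩ := Multiset.exists_cons_of_mem hq
    rw [Multiset.map_cons, Multiset.map_cons, hqp, Multiset.cons_inj_right] at h
    obtain ⟨R, h1, h2⟩ := ih Q' h
    refine ⟨(p.1, p.2, q.2) ::ₘ R, by simp [h1], ?_⟩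
    simp [h2, ← hqp]

lemma sum_map_le_of_triangle {α : Type*} (d : α × α → ℝ)
    (hd : ∀ a b c, d (a, c) ≤ d (a, b) + d (b, c)) (R : Multiset (α × α × α)) :
    (R.map (fun r => d (r.1, r.2.2))).sum ≤
      ((R.map (fun r => (r.1, r.2.1))).map d).sum + ((R.map Prod.snd).map d).sum := by
  rw [Multiset.map_map, Multiset.map_map, ← Multiset.sum_map_add]
  exact Multiset.sum_map_le_sum_map _ _ (fun r _ => hd _ _ _)

lemma Close.trans {c c' : ℝ} {D E F : Diagram} (h : Close c D E) (h' : Close c' E F) :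
    Close (c + c') D F := by
  obtain ⟨P, Q, h1, h2, h3, h4, h5⟩ := h
  obtain ⟨P', Q', h1', h2', h3', h4', h5'⟩ := h'
  set d := (P.map Prod.snd).filter (fun p => ¬ p.1 ≠ p.2) with hd
  set d' := (P'.map Prod.fst).filter (fun p => ¬ p.1 ≠ p.2) with hd'
  have e1 : P.map Prod.snd = E.finite + d := by
    rw [← h2, hd, Multiset.filter_add_not]
  have e2 : P'.map Prod.fst = E.finite + d' := by
    rw [← h1', hd', Multiset.filter_add_not]
  have z1 : d.filter (fun p => p.1 ≠ p.2) = 0 := by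
    rw [Multiset.filter_eq_nil]; intro a ha; exact (Multiset.mem_filter.1 ha).2
  have z2 : d'.filter (fun p => p.1 ≠ p.2) = 0 := by
    rw [Multiset.filter_eq_nil]; intro a ha; exact (Multiset.mem_filter.1 ha).2
  -- Each matching is padded with the diagonal points of the other, matched with themselves at no
  -- cost; the middle multisets then agree.
  obtain ⟨R, r1, r2⟩ := exists_glue (P + d'.map (fun x => (x, x))) (P' + d.map (fun x => (x, x)))
    (by
      simp only [Multiset.map_add, Multiset.map_map, Function.comp_def, Multiset.map_id', e1, e2]
      abel)
  obtain ⟨S, s1, s2⟩ := exists_glue Q Q' (by rw [h4, h3'])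
  refine ⟨R.map (fun r => (r.1, r.2.2)), S.map (fun r => (r.1, r.2.2)), ?_, ?_, ?_, ?_, ?_⟩
  · have : (R.map (fun r => (r.1, r.2.2))).map Prod.fst
        = (R.map (fun r => (r.1, r.2.1))).map Prod.fst := by simp
    rw [this, r1]
    rw [Multiset.map_add, Multiset.filter_add, h1, Multiset.map_map]
    simp only [Function.comp_def, Multiset.map_id']
    rw [z2, add_zero]
  · have : (R.map (fun r => (r.1, r.2.2))).map Prod.snd = (R.map Prod.snd).map Prod.snd := by simp
    rw [this, r2]
    rw [Multiset.map_add, Multiset.filter_add, h2', Multiset.map_map]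
    simp only [Function.comp_def, Multiset.map_id']
    rw [z1, add_zero]
  · have : (S.map (fun r => (r.1, r.2.2))).map Prod.fst
        = (S.map (fun r => (r.1, r.2.1))).map Prod.fst := by simp
    rw [this, s1, h3]
  · have : (S.map (fun r => (r.1, r.2.2))).map Prod.snd = (S.map Prod.snd).map Prod.snd := by simp
    rw [this, s2, h4']
  · have a1 := sum_map_le_of_triangle taxi taxi_triangle R
    have a2 := sum_map_le_of_triangle (fun z : ℝ × ℝ => |z.1 - z.2|)
      (fun a b c => abs_sub_le a b c) S
    rw [r1, r2] at a1
    rw [s1, s2] at a2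
    simp only [Multiset.map_add, Multiset.map_map, Function.comp_def, Multiset.sum_add, taxi_self,
      Multiset.map_const', Multiset.sum_replicate, smul_zero, add_zero] at a1 a2 ⊢
    linarith

lemma Close.symm {c : ℝ} {D E : Diagram} (h : Close c D E) : Close c E D := by
  obtain ⟨P, Q, h1, h2, h3, h4, h5⟩ := h
  refine ⟨P.map Prod.swap, Q.map Prod.swap, ?_, ?_, ?_, ?_, ?_⟩
  · simpa using h2
  · simpa using h1
  · simpa using h4
  · simpa using h3
  · have h (z : (ℝ × ℝ) × (ℝ × ℝ)) : taxi z.swap = taxi z := by simp [taxi, abs_sub_comm]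
    simpa only [Multiset.map_map, Function.comp_def, h, Prod.fst_swap, Prod.snd_swap,
      abs_sub_comm] using h5

lemma Close.mono {c c' : ℝ} {D E : Diagram} (h : Close c D E) (hc : c ≤ c') : Close c' D E := by
  obtain ⟨P, Q, h1, h2, h3, h4, h5⟩ := h
  exact ⟨P, Q, h1, h2, h3, h4, h5.trans hc⟩

/-- Add a point to a diagram, unless it is on the diagonal. -/
def Diagram.insert (p : ℝ × ℝ) (D : Diagram) : Diagram :=
  ⟨(p ::ₘ D.finite).filter (fun p => p.1 ≠ p.2), D.essential⟩

lemma Close.insert {c : ℝ} {D E : Diagram} (h : Close c D E) (p p' : ℝ × ℝ) :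
    Close (taxi (p, p') + c) (D.insert p) (E.insert p') := by
  obtain ⟨P, Q, h1, h2, h3, h4, h5⟩ := h
  refine ⟨(p, p') ::ₘ P, Q, ?_, ?_, h3, h4, ?_⟩
  · simp only [Diagram.insert, ← h1, Multiset.map_cons, Multiset.filter_cons,
      Multiset.filter_filter, and_self]
  · simp only [Diagram.insert, ← h2, Multiset.map_cons, Multiset.filter_cons,
      Multiset.filter_filter, and_self]
  · simp only [Multiset.map_cons, Multiset.sum_cons]; linarith

/-- The corner `(p'.1, p.2)` splits the way into two axis-parallel segments, whose lengths do not
depend on `q`. -/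
lemma edist_toLp_le (q : ℝ≥0∞) [Fact (1 ≤ q)] (p p' : ℝ × ℝ) :
    edist (WithLp.toLp q p) (WithLp.toLp q p') ≤ ENNReal.ofReal (taxi (p, p')) := by
  have h1 : edist (WithLp.toLp q p) (WithLp.toLp q (p'.1, p.2)) = edist p.1 p'.1 := by
    rw [edist_dist, edist_dist, dist_eq_norm, dist_eq_norm, ← WithLp.toLp_sub]
    congr 1
    have : p - (p'.1, p.2) = (p.1 - p'.1, 0) := by ext <;> simp
    rw [this]
    exact WithLp.norm_toLp_fst q ℝ ℝ _
  have h2 : edist (WithLp.toLp q (p'.1, p.2)) (WithLp.toLp q p') = edist p.2 p'.2 := by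
    rw [edist_dist, edist_dist, dist_eq_norm, dist_eq_norm, ← WithLp.toLp_sub]
    congr 1
    have : (p'.1, p.2) - p' = (0, p.2 - p'.2) := by ext <;> simp
    rw [this]
    exact WithLp.norm_toLp_snd q ℝ ℝ _
  refine (edist_triangle _ (WithLp.toLp q (p'.1, p.2)) _).trans ?_
  rw [h1, h2, taxi, ENNReal.ofReal_add (abs_nonneg _) (abs_nonneg _), edist_dist, edist_dist,
    Real.dist_eq, Real.dist_eq]

lemma sum_map_le_ofReal {α : Type*} (f : α → ℝ≥0∞) (g : α → ℝ) (hg : ∀ a, 0 ≤ g a)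
    (h : ∀ a, f a ≤ ENNReal.ofReal (g a)) (P : Multiset α) :
    (P.map f).sum ≤ ENNReal.ofReal (P.map g).sum := by
  induction P using Multiset.induction_on with
  | empty => simp
  | cons a P ih =>
    rw [Multiset.map_cons, Multiset.map_cons, Multiset.sum_cons, Multiset.sum_cons,
      ENNReal.ofReal_add (hg a) (Multiset.sum_nonneg (by simpa using fun a _ => hg a))]
    exact add_le_add (h a) ih

lemma Close.wasserstein1_le (q : ℝ≥0∞) [Fact (1 ≤ q)] {c : ℝ} {D E : Diagram} (h : Close c D E) :
    wasserstein1 q D E ≤ ENNReal.ofReal c := by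
  obtain ⟨P, Q, h1, h2, h3, h4, h5⟩ := h
  refine (iInf_le _ (⟨P, (P.map Prod.fst).filter (fun p => ¬ p.1 ≠ p.2),
    (P.map Prod.snd).filter (fun p => ¬ p.1 ≠ p.2), ?_, ?_, ?_, ?_, Q, h3, h4⟩ :
      DiagramMatching D E)).trans ?_
  · intro p hp; simpa using (Multiset.mem_filter.1 hp).2
  · intro p hp; simpa using (Multiset.mem_filter.1 hp).2
  · rw [← h1, Multiset.filter_add_not]
  · rw [← h2, Multiset.filter_add_not]
  · have b1 := sum_map_le_ofReal
      (fun p : (ℝ × ℝ) × (ℝ × ℝ) => edist (WithLp.toLp q p.1) (WithLp.toLp q p.2)) taxi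
      (fun a => by unfold taxi; positivity) (fun a => edist_toLp_le q a.1 a.2) P
    have b2 := sum_map_le_ofReal (fun p : ℝ × ℝ => edist p.1 p.2) (fun z => |z.1 - z.2|)
      (fun a => abs_nonneg _) (fun a => by rw [edist_dist, Real.dist_eq]) Q
    refine (add_le_add b1 b2).trans ?_
    rw [← ENNReal.ofReal_add]
    · exact ENNReal.ofReal_le_ofReal h5
    · exact Multiset.sum_nonneg (by
        intro x hx; obtain ⟨z, -, rfl⟩ := Multiset.mem_map.1 hx; unfold taxi; positivity)
    · exact Multiset.sum_nonneg (by
        intro x hx; obtain ⟨z, -, rfl⟩ := Multiset.mem_map.1 hx; positivity)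

/-! ### Components of sublevel sets -/

lemma plExtension_natCast (s : List ℝ) (k : ℕ) : plExtension s k = s.getD k 0 := by
  simp [plExtension]

lemma getD_eq_get (s : List ℝ) (k : Fin s.length) : s.getD k.val 0 = s.get k := by
  simp

lemma plExtension_le (s : List ℝ) (t : ℝ) {i j : ℕ}
    (h : ∀ k, i ≤ k → k ≤ j → s.getD k 0 ≤ t) {u : ℝ} (hi : (i : ℝ) ≤ u) (hj : u ≤ j) :
    plExtension s u ≤ t := by
  have hu0 : 0 ≤ u := le_trans (Nat.cast_nonneg i) hi
  have h1 : i ≤ ⌊u⌋₊ := Nat.le_floor hi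
  have h2 : ⌊u⌋₊ ≤ j := Nat.floor_le_of_le hj
  have h3 := Nat.floor_le hu0
  have h4 := Nat.lt_floor_add_one u
  have hk := h _ h1 h2
  -- If `⌊u⌋₊ = j`, the sample `j + 1` is not controlled, but then `u = j` and its coefficient
  -- vanishes.
  rcases eq_or_lt_of_le h2 with he | hlt
  · have : u = (⌊u⌋₊ : ℝ) := le_antisymm (by rw [he]; exact hj) h3
    unfold plExtension
    rw [← this]; simpa using hk
  · have hk' := h (⌊u⌋₊ + 1) (by omega) hlt
    unfold plExtension
    nlinarith [mul_nonneg (sub_nonneg.2 h3) (sub_nonneg.2 hk'),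
      mul_nonneg (sub_nonneg.2 h4.le) (sub_nonneg.2 hk)]

/-- A path in the line passes through all intermediate times; conversely, interpolation never
exceeds the larger of two samples, so the whole segment stays in the sublevel. -/
lemma joinedIn_sublevel (s : List ℝ) (t : ℝ) {i j : ℕ} (hij : i ≤ j) (hj : j < s.length) :
    JoinedIn (sublevel s t) (i : ℝ) (j : ℝ) ↔ ∀ k, i ≤ k → k ≤ j → s.getD k 0 ≤ t := by
  constructor
  · rintro ⟨γ, hγ⟩ k hik hkj
    have hc : (Set.range γ).OrdConnected := by
      have : IsPreconnected (Set.range γ) := isPreconnected_range γ.continuous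
      exact this.ordConnected
    have : (k : ℝ) ∈ Set.range γ :=
      hc.out (x := i) (y := j) ⟨0, γ.source⟩ ⟨1, γ.target⟩
        ⟨by exact_mod_cast hik, by exact_mod_cast hkj⟩
    obtain ⟨τ, hτ⟩ := this
    have h := (hγ τ).2.2
    rwa [hτ, plExtension_natCast] at h
  · intro h
    have hsub : Set.Icc (i : ℝ) j ⊆ sublevel s t := by
      rintro u ⟨h1, h2⟩
      refine ⟨le_trans (Nat.cast_nonneg i) h1, ?_, plExtension_le s t h h1 h2⟩
      have : (j : ℝ) + 1 ≤ s.length := by exact_mod_cast hj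
      linarith
    have hij' : (i : ℝ) ≤ j := by exact_mod_cast hij
    exact (((convex_Icc (i : ℝ) j).isPathConnected ⟨i, by simp [hij]⟩).joinedIn _
      (by simp [hij]) _ (by simp [hij])).mono hsub

/-- All samples between `i` and `j` are at most `t`. -/
def Below (s : List ℝ) (t : ℝ) (i j : Fin s.length) : Prop :=
  ∀ k : Fin s.length, min i j ≤ k → k ≤ max i j → s.get k ≤ t

lemma sameComponent_iff (s : List ℝ) (t : ℝ) (i j : Fin s.length) :
    SameComponent s t i j ↔ Below s t i j := by
  have key : ∀ a b : Fin s.length, a ≤ b →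
      ((∀ k : ℕ, a.val ≤ k → k ≤ b.val → s.getD k 0 ≤ t) ↔
        ∀ k : Fin s.length, a ≤ k → k ≤ b → s.get k ≤ t) := by
    intro a b _
    constructor
    · intro h k h1 h2
      rw [← getD_eq_get]; exact h k h1 h2
    · intro h k h1 h2
      have hk : k < s.length := lt_of_le_of_lt h2 b.2
      have := h ⟨k, hk⟩ h1 h2
      rwa [← getD_eq_get] at this
  unfold SameComponent Below
  rcases le_total i j with h | h
  · rw [joinedIn_sublevel s t h j.2, key i j h, min_eq_left h, max_eq_right h]
  · rw [show JoinedIn (sublevel s t) (i.val : ℝ) (j.val : ℝ) ↔ JoinedIn (sublevel s t) (j.val : ℝ)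
      (i.val : ℝ) from ⟨JoinedIn.symm, JoinedIn.symm⟩, joinedIn_sublevel s t h i.2, key j i h,
      min_eq_right h, max_eq_left h]

lemma Below.symm {s : List ℝ} {t : ℝ} {i j : Fin s.length} (h : Below s t i j) :
    Below s t j i := by
  intro k; rw [min_comm, max_comm]; exact h k

lemma Below.trans {s : List ℝ} {t : ℝ} {i j l : Fin s.length} (h : Below s t i j)
    (h' : Below s t j l) : Below s t i l := by
  intro k h1 h2
  by_cases hk : min i j ≤ k ∧ k ≤ max i j
  · exact h k hk.1 hk.2
  · refine h' k ?_ ?_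
    · simp only [min_le_iff, le_max_iff] at *; omega
    · simp only [min_le_iff, le_max_iff] at *; omega

lemma Older.irrefl (s : List ℝ) (i : Fin s.length) : ¬ Older s i i := by
  simp [Older]

lemma Older.trans {s : List ℝ} {i j k : Fin s.length} (h : Older s i j) (h' : Older s j k) :
    Older s i k := by
  unfold Older at *
  rcases h with h | ⟨h, h1⟩ <;> rcases h' with h' | ⟨h', h1'⟩
  · exact Or.inl (h.trans h')
  · exact Or.inl (h' ▸ h)
  · exact Or.inl (h ▸ h')
  · exact Or.inr ⟨h.trans h', h1.trans h1'⟩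

lemma Older.total (s : List ℝ) (i j : Fin s.length) : Older s i j ∨ i = j ∨ Older s j i := by
  unfold Older
  rcases lt_trichotomy (s.get i) (s.get j) with h | h | h
  · exact Or.inl (Or.inl h)
  · rcases lt_trichotomy i j with h' | h' | h'
    · exact Or.inl (Or.inr ⟨h, h'⟩)
    · exact Or.inr (Or.inl h')
    · exact Or.inr (Or.inr (Or.inr ⟨h.symm, h'⟩))
  · exact Or.inr (Or.inr (Or.inl h))

lemma Older.get_le {s : List ℝ} {i j : Fin s.length} (h : Older s i j) : s.get i ≤ s.get j := by
  rcases h with h | h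
  · exact h.le
  · exact h.1.le

/-- The heights at which `i` has been merged with something older form a closed up-set, so the
infimum is attained. Without `ho` this set would be empty and `sInf` would be the default value `0`.
-/
lemma lt_death_iff (s : List ℝ) (i : Fin s.length) (ho : ∃ j, Older s j i) (t : ℝ) :
    t < death s i ↔ ∀ j, Older s j i → ¬ Below s t i j := by
  set S : Set ℝ := {t | ∃ j, Older s j i ∧ Below s t i j} with hS
  have hd : death s i = sInf S := by
    unfold death; simp only [sameComponent_iff, hS]
  have hclosed : IsClosed S := by
    have : S = ⋃ j : Fin s.length, {t | Older s j i ∧ Below s t i j} := by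
      ext; simp [hS]
    rw [this]
    refine isClosed_iUnion_of_finite fun j => ?_
    by_cases hj : Older s j i
    · simp only [hj, true_and, Below, Set.ofPred_forall]
      exact isClosed_iInter fun k => isClosed_iInter fun _ => isClosed_iInter fun _ => isClosed_Ici
    · simp [hj]
  have hbdd : BddBelow S := ⟨s.get i, by
    rintro u ⟨j, -, h⟩
    exact h i (min_le_left _ _) (le_max_left _ _)⟩
  have hne : S.Nonempty := by
    obtain ⟨j, hj⟩ := ho
    refine ⟨∑ k, |s.get k|, j, hj, fun k _ _ => (le_abs_self _).trans ?_⟩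
    exact Finset.single_le_sum (f := fun k => |s.get k|) (fun _ _ => abs_nonneg _)
      (Finset.mem_univ k)
  have hmem := hclosed.csInf_mem hne hbdd
  rw [hd]
  constructor
  · intro h j hj hb
    exact absurd (csInf_le hbdd ⟨j, hj, hb⟩) (not_le.2 h)
  · intro h
    by_contra hlt
    obtain ⟨j, hj, hb⟩ := hmem
    exact h j hj fun k h1 h2 => (hb k h1 h2).trans (not_lt.1 hlt)

-- Every class that meets `X` has exactly one `lt`-minimal member in `X`, so the count does not
-- depend on the order. This lets the oldest sample of a component be exchanged for the earliest in
-- time.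
open Classical in
lemma card_minimal_eq_card_image {α : Type*} [Finite α] (X : Finset α) (r : Setoid α)
    (lt : α → α → Prop) (irr : ∀ a, ¬ lt a a) (tr : ∀ a b c, lt a b → lt b c → lt a c)
    (tot : ∀ a b, lt a b ∨ a = b ∨ lt b a) :
    (X.filter (fun a => ∀ b ∈ X, lt b a → ¬ r a b)).card =
      (X.image (Quotient.mk r)).card := by
  rw [← Finset.card_image_of_injOn (s := X.filter _) (f := Quotient.mk r)]
  · congr 1
    apply Finset.Subset.antisymm
    · exact Finset.image_subset_image (Finset.filter_subset _ _)
    · intro c hc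
      obtain ⟨a, ha, rfl⟩ := Finset.mem_image.1 hc
      have : IsTrans α lt := ⟨tr⟩
      have : Std.Irrefl lt := ⟨irr⟩
      obtain ⟨m, ⟨hm, hma⟩, hmin⟩ := (Finite.wellFounded_of_trans_of_irrefl lt).has_min
        {b | b ∈ X ∧ r b a} ⟨a, ha, r.refl a⟩
      refine Finset.mem_image.2 ⟨m, Finset.mem_filter.2 ⟨hm, fun b hb hlt hr => ?_⟩,
        Quotient.sound hma⟩
      exact hmin b ⟨hb, r.trans (r.symm hr) hma⟩ hlt
  · intro a ha b hb hab
    have hab' : r a b := Quotient.exact hab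
    simp only [Finset.coe_filter, Set.mem_ofPred_eq] at ha hb
    rcases tot a b with h | h | h
    · exact absurd (r.symm hab') (hb.2 a ha.1 h)
    · exact h
    · exact absurd hab' (ha.2 b hb.1 h)

/-! ### Counting components -/

/-- Number of components at height `t'` that meet the sublevel at height `t`, for a list that is
read from left to right; the flag says whether the current component has been counted already. -/
def runCount (t t' : ℝ) : Bool → List ℝ → ℕ
  | _, [] => 0
  | b, x :: l => if x ≤ t then (if b then 0 else 1) + runCount t t' true l
      else if t' < x then runCount t t' false l else runCount t t' b l

/-- The flag of `runCount` after a list has been read. -/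
def runFlag (t t' : ℝ) : Bool → List ℝ → Bool
  | b, [] => b
  | b, x :: l => runFlag t t' (if x ≤ t then true else if t' < x then false else b) l

lemma runCount_append (t t' : ℝ) (l m : List ℝ) : ∀ b, runCount t t' b (l ++ m) =
    runCount t t' b l + runCount t t' (runFlag t t' b l) m := by
  induction l with
  | nil => simp [runCount, runFlag]
  | cons x l ih =>
    intro b
    simp only [List.cons_append, runCount, runFlag, ih]
    split_ifs <;> simp [add_assoc]

-- A component is represented by its leftmost sample of height at most `t`. The last condition
-- accounts for the flag: a component counted before the list began must first be left through a
-- sample above `t'`.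
open Classical in
lemma runCount_eq_card (t t' : ℝ) (h : t ≤ t') (l : List ℝ) : ∀ b : Bool, runCount t t' b l =
    (Finset.univ.filter (fun i : Fin l.length => l.get i ≤ t ∧
      (∀ j, j < i → l.get j ≤ t → ∃ k, j ≤ k ∧ k ≤ i ∧ t' < l.get k) ∧
      (b = true → ∃ k, k ≤ i ∧ t' < l.get k))).card := by
  induction l with
  | nil => intro b; simp [runCount]
  | cons x l ih =>
    intro b
    have key := Fin.card_filter_univ_succ (n := l.length)
      (p := fun i : Fin (l.length + 1) => (x :: l).get i ≤ t ∧
      (∀ j, j < i → (x :: l).get j ≤ t → ∃ k, j ≤ k ∧ k ≤ i ∧ t' < (x :: l).get k) ∧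
      (b = true → ∃ k, k ≤ i ∧ t' < (x :: l).get k))
    refine Eq.trans ?_ key.symm
    have h0 : ∀ i : Fin l.length, ¬ i.succ ≤ 0 := fun i => by simp
    have h1 : ∀ i : Fin l.length, 0 < i.succ := fun i => by simp
    simp only [Fin.forall_fin_succ, Fin.exists_fin_succ, List.get_cons_zero, List.get_cons_succ',
      Fin.succ_le_succ_iff, Fin.succ_lt_succ_iff, Fin.zero_le, true_and, h1, h0, false_and,
      forall_const, le_refl, exists_false, or_false, false_or, Fin.not_lt_zero,
      runCount, ih, IsEmpty.forall_iff]
    by_cases hx : x ≤ t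
    · have hx' : ¬ t' < x := not_lt.2 (hx.trans h)
      have e : (Finset.univ.filter (fun i : Fin l.length => l.get i ≤ t ∧
          (∀ j, j < i → l.get j ≤ t → ∃ k, j ≤ k ∧ k ≤ i ∧ t' < l.get k) ∧
          (true = true → ∃ k, k ≤ i ∧ t' < l.get k))) =
        (Finset.univ.filter (fun i : Fin l.length => l.get i ≤ t ∧
          ((∃ k, k ≤ i ∧ t' < l.get k) ∧
          ∀ j, j < i → l.get j ≤ t → ∃ k, j ≤ k ∧ k ≤ i ∧ t' < l.get k) ∧
          (b = true → ∃ k, k ≤ i ∧ t' < l.get k))) := by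
        apply Finset.filter_congr; intro i _; tauto
      simp only [hx, hx', if_true, false_or, forall_const]
      rw [← e]
      cases b <;> simp [add_comm]
    · by_cases hx' : t' < x
      · simp [hx, hx']
      · simp [hx, hx']

lemma exists_oldest {s : List ℝ} (hs : s ≠ []) :
    ∃ m : Fin s.length, ∀ i, (¬ ∃ j, Older s j i) ↔ i = m := by
  have : IsTrans (Fin s.length) (Older s) := ⟨fun _ _ _ => Older.trans⟩
  have : Std.Irrefl (Older s) := ⟨Older.irrefl s⟩
  obtain ⟨m, -, hm⟩ := (Finite.wellFounded_of_trans_of_irrefl (Older s)).has_min Set.univ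
    ⟨⟨0, List.length_pos_iff.2 hs⟩, trivial⟩
  refine ⟨m, fun i => ⟨fun h => ?_, ?_⟩⟩
  · rcases Older.total s m i with h' | h' | h'
    · exact absurd ⟨m, h'⟩ h
    · exact h'.symm
    · exact absurd h' (hm i trivial)
  · rintro rfl ⟨j, hj⟩
    exact hm j trivial hj

lemma diagram_essential {s : List ℝ} (hs : s ≠ []) :
    ∃ m ∈ s, (∀ x ∈ s, m ≤ x) ∧ (diagram s).essential = {m} := by
  classical
  obtain ⟨m, hm⟩ := exists_oldest hs
  refine ⟨s.get m, List.get_mem _ _, fun x hx => ?_, ?_⟩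
  · obtain ⟨i, rfl⟩ := List.get_of_mem hx
    rcases Older.total s m i with h' | h' | h'
    · exact h'.get_le
    · rw [h']
    · exact absurd ⟨i, h'⟩ ((hm m).2 rfl)
  · simp [diagram, hm, Finset.filter_eq']

lemma diagram_essential_eq {s s' : List ℝ} (hs' : s' ≠ []) (h : ∀ x ∈ s', x ∈ s)
    (h' : ∀ x ∈ s, ∃ y ∈ s', y ≤ x) : (diagram s).essential = (diagram s').essential := by
  have hs : s ≠ [] := by
    rintro rfl
    obtain ⟨x, hx⟩ := List.exists_mem_of_ne_nil s' hs'
    simpa using h x hx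
  obtain ⟨m, h1, h2, h3⟩ := diagram_essential hs
  obtain ⟨m', h1', h2', h3'⟩ := diagram_essential hs'
  obtain ⟨y, hy, hym⟩ := h' m h1
  rw [h3, h3', le_antisymm (h2 _ (h _ h1')) ((h2' y hy).trans hym)]

lemma diagram_fst_lt_snd (s : List ℝ) : ∀ p ∈ (diagram s).finite, p.1 < p.2 := by
  intro p hp
  simp only [diagram, Multiset.mem_map, Finset.mem_val, Finset.mem_filter] at hp
  obtain ⟨i, ⟨-, -, h⟩, rfl⟩ := hp
  exact h

open Classical in
lemma countP_diagram {s : List ℝ} (hs : s ≠ []) {t t' : ℝ} (h : t ≤ t') :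
    (diagram s).finite.countP (fun p => p.1 ≤ t ∧ t' < p.2) +
      (diagram s).essential.countP (fun b => b ≤ t) = runCount t t' false s := by
  obtain ⟨m, hm⟩ := exists_oldest hs
  set X : Finset (Fin s.length) := Finset.univ.filter (fun i => s.get i ≤ t) with hX
  -- Equality is adjoined because `Below s t' i i` fails for samples above `t'`.
  let r : Setoid (Fin s.length) :=
    { r := fun i j => i = j ∨ Below s t' i j
      iseqv := ⟨fun _ => Or.inl rfl, fun h => h.imp Eq.symm Below.symm, by
        rintro a b c (rfl | h1) (rfl | h2)
        · exact Or.inl rfl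
        · exact Or.inr h2
        · exact Or.inr h1
        · exact Or.inr (h1.trans h2)⟩ }
  have e1 := card_minimal_eq_card_image X r (Older s) (Older.irrefl s) (fun _ _ _ => Older.trans)
    (Older.total s)
  have e2 := card_minimal_eq_card_image X r (fun i j => i < j) (fun _ => lt_irrefl _)
    (fun _ _ _ => lt_trans) lt_trichotomy
  have e3 : runCount t t' false s = (X.image (Quotient.mk r)).card := by
    rw [runCount_eq_card t t' h s false, ← e2]
    congr 1
    ext i
    simp only [hX, Bool.false_eq_true, false_imp_iff, and_true, Finset.mem_filter, Finset.mem_univ,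
      true_and, and_true]
    refine and_congr_right fun hi => forall_congr' fun j => ⟨fun H hj hji => ?_, fun H hji hj => ?_⟩
    · obtain ⟨k, h1, h2, h3⟩ := H hji hj
      rintro (rfl | hb)
      · exact lt_irrefl _ hji
      · exact not_lt.2 (hb k ((min_le_right _ _).trans h1) (h2.trans (le_max_left _ _))) h3
    · by_contra! hc
      refine H hj hji (Or.inr fun k h1 h2 => hc k ?_ ?_)
      · rwa [min_eq_right hji.le] at h1
      · rwa [max_eq_left hji.le] at h2
  have e4 : (diagram s).finite.countP (fun p => p.1 ≤ t ∧ t' < p.2) =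
      ((X.filter (fun a => ∀ b ∈ X, Older s b a → ¬ r a b)).filter
        (fun i => ∃ j, Older s j i)).card := by
    simp only [diagram, Multiset.countP_map]
    rw [← Finset.filter_val, Finset.card_val]
    congr 1
    ext i
    simp only [hX, Finset.mem_filter, Finset.mem_univ, true_and]
    constructor
    · rintro ⟨⟨ho, -⟩, h1, h2⟩
      refine ⟨⟨h1, fun b _ hb => ?_⟩, ho⟩
      rintro (rfl | hc)
      · exact Older.irrefl _ _ hb
      · exact (lt_death_iff s i ho t').1 h2 b hb hc
    · rintro ⟨⟨h1, h2⟩, ho⟩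
      have : t' < death s i := (lt_death_iff s i ho t').2 fun j hj hc =>
        h2 j (hj.get_le.trans h1) hj (Or.inr hc)
      exact ⟨⟨ho, by linarith⟩, h1, this⟩
  have e5 : (diagram s).essential.countP (fun b => b ≤ t) =
      ((X.filter (fun a => ∀ b ∈ X, Older s b a → ¬ r a b)).filter
        (fun i => ¬ ∃ j, Older s j i)).card := by
    simp only [diagram, Multiset.countP_map]
    rw [← Finset.filter_val, Finset.card_val]
    congr 1
    ext i
    simp only [hX, Finset.mem_filter, Finset.mem_univ, true_and]
    constructor
    · rintro ⟨ho, h1⟩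
      exact ⟨⟨h1, fun b _ hb => absurd ⟨b, hb⟩ ho⟩, ho⟩
    · rintro ⟨⟨h1, -⟩, ho⟩
      exact ⟨ho, h1⟩
  rw [e3, ← e1, e4, e5, Finset.card_filter_add_card_filter_not]
  congr!

/-! ### Multisets of points above the diagonal are determined by quadrant counts -/

lemma exists_between_below (Z : Finset ℝ) {b d : ℝ} (h : b < d) :
    ∃ t, b ≤ t ∧ t < d ∧ ∀ z ∈ Z, z < d → z ≤ t := by
  induction Z using Finset.induction_on with
  | empty => exact ⟨b, le_rfl, h, by simp⟩
  | insert a Z _ ih =>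
    obtain ⟨t, h1, h2, h3⟩ := ih
    by_cases ha : a < d
    · refine ⟨max t a, h1.trans (le_max_left _ _), max_lt h2 ha, fun z hz hzd => ?_⟩
      rcases Finset.mem_insert.1 hz with rfl | hz
      · exact le_max_right _ _
      · exact (h3 z hz hzd).trans (le_max_left _ _)
    · refine ⟨t, h1, h2, fun z hz hzd => ?_⟩
      rcases Finset.mem_insert.1 hz with rfl | hz
      · exact absurd hzd ha
      · exact h3 z hz hzd

-- Choose a quadrant whose corner height `t` is so close below `p.2` that no death in `G` lies
-- strictly between them. It contains `p`, hence some `q ∈ G`, and extremality of `p` forces `q =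
-- p`.
open Classical in
lemma mem_of_countP_quadrant_eq {F G : Multiset (ℝ × ℝ)}
    (h : ∀ t t' : ℝ, t ≤ t' → F.countP (fun p => p.1 ≤ t ∧ t' < p.2) =
      G.countP (fun p => p.1 ≤ t ∧ t' < p.2)) {p : ℝ × ℝ} (hp : p ∈ F) (hlt : p.1 < p.2)
    (hext : ∀ q ∈ G, p.1 < q.1 ∨ p.1 = q.1 ∧ q.2 ≤ p.2) : p ∈ G := by
  obtain ⟨t, h1, h2, h3⟩ := exists_between_below (G.map Prod.snd).toFinset hlt
  have hpos : 0 < F.countP (fun q => q.1 ≤ p.1 ∧ t < q.2) :=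
    Multiset.countP_pos.2 ⟨p, hp, le_rfl, h2⟩
  rw [h _ _ h1] at hpos
  obtain ⟨q, hq, hq1, hq2⟩ := Multiset.countP_pos.1 hpos
  rcases hext q hq with hlt' | ⟨he, hle⟩
  · exact absurd hlt' (not_lt.2 hq1)
  · have : p.2 ≤ q.2 := by
      by_contra! hc
      exact absurd (h3 q.2 (by simpa using ⟨q.1, hq⟩) hc) (not_le.2 hq2)
    rwa [Prod.ext he (le_antisymm this hle)]

open Classical in
lemma eq_of_countP_quadrant_eq : ∀ (n : ℕ) {F G : Multiset (ℝ × ℝ)}, F.card = n →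
    (∀ p ∈ F, p.1 < p.2) → (∀ p ∈ G, p.1 < p.2) →
    (∀ t t' : ℝ, t ≤ t' → F.countP (fun p => p.1 ≤ t ∧ t' < p.2) =
      G.countP (fun p => p.1 ≤ t ∧ t' < p.2)) → F = G := by
  intro n
  induction n with
  | zero =>
    intro F G hF _ hG h
    rw [Multiset.card_eq_zero] at hF
    subst hF
    symm
    refine Multiset.eq_zero_of_forall_notMem fun p hp => ?_
    have := h p.1 p.1 le_rfl
    rw [Multiset.countP_zero, eq_comm, Multiset.countP_eq_zero] at this
    exact this p hp ⟨le_rfl, hG p hp⟩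
  | succ n ih =>
    intro F G hn hF hG h
    have hne : (F + G).toFinset.Nonempty := by
      obtain ⟨p, hp⟩ := Multiset.card_pos_iff_exists_mem.1 (by omega : 0 < F.card)
      exact ⟨p, by simp [hp]⟩
    -- Least birth and, among these, largest death: such a point belongs to both multisets and can
    -- be split off.
    obtain ⟨p, hp, hmin⟩ := Finset.exists_min_image (F + G).toFinset
      (fun p : ℝ × ℝ => toLex (p.1, -p.2)) hne
    have hmin' : ∀ q ∈ F + G, p.1 < q.1 ∨ p.1 = q.1 ∧ q.2 ≤ p.2 := by
      intro q hq
      simpa [Prod.Lex.toLex_le_toLex] using hmin q (by simpa using hq)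
    have hFG : p ∈ F ∧ p ∈ G := by
      rcases Multiset.mem_add.1 (Multiset.mem_toFinset.1 hp) with hp | hp
      · exact ⟨hp, mem_of_countP_quadrant_eq h hp (hF p hp)
          fun q hq => hmin' q (Multiset.mem_add.2 (Or.inr hq))⟩
      · exact ⟨mem_of_countP_quadrant_eq (fun t t' ht => (h t t' ht).symm) hp (hG p hp)
          fun q hq => hmin' q (Multiset.mem_add.2 (Or.inl hq)), hp⟩
    obtain ⟨F', rfl⟩ := Multiset.exists_cons_of_mem hFG.1
    obtain ⟨G', rfl⟩ := Multiset.exists_cons_of_mem hFG.2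
    congr 1
    refine ih (by simpa using hn) (fun q hq => hF q (Multiset.mem_cons_of_mem hq))
      (fun q hq => hG q (Multiset.mem_cons_of_mem hq)) fun t t' ht => ?_
    have := h t t' ht
    simpa only [Multiset.countP_cons, Nat.add_right_cancel_iff] using this

open Classical in
/-- If the component counts of two lists differ by those of a single point, then so do the
diagrams. -/
lemma diagram_eq_insert {s s' : List ℝ} (hs : s ≠ []) (hs' : s' ≠ []) {u v : ℝ} (huv : u ≤ v)
    (he : (diagram s).essential = (diagram s').essential)
    (h : ∀ t t' : ℝ, t ≤ t' → runCount t t' false s =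
      (if u ≤ t ∧ t' < v then 1 else 0) + runCount t t' false s') :
    diagram s = (diagram s').insert (u, v) := by
  have hfin : (diagram s).finite = ((diagram s').insert (u, v)).finite := by
    refine eq_of_countP_quadrant_eq _ rfl (diagram_fst_lt_snd s) ?_ fun t t' ht => ?_
    · intro p hp
      simp only [Diagram.insert, Multiset.mem_filter, Multiset.mem_cons] at hp
      rcases hp with ⟨rfl | hp, hne⟩
      · exact lt_of_le_of_ne huv hne
      · exact diagram_fst_lt_snd s' p hp
    · have h1 := countP_diagram hs ht
      have h2 := countP_diagram hs' ht
      have h3 := h t t' ht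
      rw [he] at h1
      have h4 : ((diagram s').insert (u, v)).finite.countP (fun p => p.1 ≤ t ∧ t' < p.2) =
          ((u, v) ::ₘ (diagram s').finite).countP (fun p => p.1 ≤ t ∧ t' < p.2) := by
        simp only [Diagram.insert, Multiset.countP_filter]
        refine Multiset.countP_congr rfl fun p _ => ?_
        refine propext ⟨fun h => h.1, fun h => ⟨h, fun h' => ?_⟩⟩
        linarith [h.1, h.2]
      rw [h4, Multiset.countP_cons]
      simp only
      omega
  have h0 : ((diagram s').insert (u, v)).essential = (diagram s').essential := rfl
  rw [← h0] at he
  cases hd : diagram s; cases hd' : (diagram s').insert (u, v)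
  simp_all

open Classical in
lemma diagram_eq_of_runCount_eq {s s' : List ℝ} (hs : s ≠ []) (hs' : s' ≠ [])
    (he : (diagram s).essential = (diagram s').essential)
    (h : ∀ t t' : ℝ, t ≤ t' → runCount t t' false s = runCount t t' false s') :
    diagram s = diagram s' := by
  -- The diagonal point `(0, 0)` lies in no quadrant and is discarded by `Diagram.insert`.
  have := diagram_eq_insert hs hs' (le_refl (0 : ℝ)) he (fun t t' ht => by
    rw [h t t' ht, if_neg (fun hc => by linarith [hc.1, hc.2]), zero_add])
  rw [this, Diagram.insert]
  have hf : ((0, 0) ::ₘ (diagram s').finite).filter (fun p => p.1 ≠ p.2) = (diagram s').finite := by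
    rw [Multiset.filter_cons_of_neg _ (by simp), Multiset.filter_eq_self]
    exact fun p hp => (diagram_fst_lt_snd s' p hp).ne
  rw [hf]

/-! ### Reductions of lists and of their diagrams -/

/-- `u` lies between `p` and `r`. -/
def Btw {α : Type*} [LE α] (p u r : α) : Prop := (p ≤ u ∧ u ≤ r) ∨ (r ≤ u ∧ u ≤ p)

/-- Removal of an element that is not a strict local extremum. -/
inductive Drops {α : Type*} [LE α] : List α → List α → Prop
  | head (p u : α) (R : List α) (h : u ≤ p) : Drops (p :: u :: R) (u :: R)
  | last (L : List α) (u p : α) (h : u ≤ p) : Drops (L ++ [u, p]) (L ++ [u])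
  | mid (L : List α) (p u r : α) (R : List α) (h : Btw p u r) :
      Drops (L ++ p :: u :: r :: R) (L ++ p :: r :: R)

/-- Removal of a minimum `u` and an adjacent maximum `v` that are paired by persistence. -/
inductive Cancels {α : Type*} [LE α] (u v : α) : List α → List α → Prop
  | head (r : α) (R : List α) (h : r ≤ u) (h' : u ≤ v) : Cancels u v (u :: v :: r :: R) (r :: R)
  | last (L : List α) (r : α) (h : r ≤ u) (h' : u ≤ v) : Cancels u v (L ++ [r, v, u]) (L ++ [r])
  | desc (L : List α) (p r : α) (R : List α) (h : r ≤ u) (h' : u ≤ v) (h'' : v ≤ p) :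
      Cancels u v (L ++ p :: u :: v :: r :: R) (L ++ p :: r :: R)
  | asc (L : List α) (p r : α) (R : List α) (h : p ≤ u) (h' : u ≤ v) (h'' : v ≤ r) :
      Cancels u v (L ++ p :: v :: u :: r :: R) (L ++ p :: r :: R)

/-- With `f` a projection of `ℝ × ℝ`, a reduction for the product order acts on both coordinates at
once. -/
lemma Drops.map {α β : Type*} [Preorder α] [Preorder β] {f : α → β} (hf : Monotone f)
    {l l' : List α} (h : Drops l l') : Drops (l.map f) (l'.map f) := by
  cases h with
  | head p u R h => exact .head _ _ _ (hf h)
  | last L u p h => simpa using Drops.last (L.map f) _ _ (hf h)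
  | mid L p u r R h =>
    simpa using Drops.mid (L.map f) _ _ _ (R.map f)
      (h.imp (And.imp (@hf _ _) (@hf _ _)) (And.imp (@hf _ _) (@hf _ _)))

lemma Cancels.map {α β : Type*} [Preorder α] [Preorder β] {f : α → β} (hf : Monotone f)
    {u v : α} {l l' : List α} (h : Cancels u v l l') :
    Cancels (f u) (f v) (l.map f) (l'.map f) := by
  cases h with
  | head r R h h' => exact .head _ _ (hf h) (hf h')
  | last L r h h' => simpa using Cancels.last (L.map f) _ (hf h) (hf h')
  | desc L p r R h h' h'' =>
    simpa using Cancels.desc (L.map f) _ _ (R.map f) (hf h) (hf h') (hf h'')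
  | asc L p r R h h' h'' =>
    simpa using Cancels.asc (L.map f) _ _ (R.map f) (hf h) (hf h') (hf h'')

/-! ### Effect of the reductions on component counts -/

lemma runCount_cons_congr {t t' : ℝ} {l m : List ℝ} (x : ℝ)
    (h : ∀ b, runCount t t' b l = runCount t t' b m) (b : Bool) :
    runCount t t' b (x :: l) = runCount t t' b (x :: m) := by
  simp only [runCount, h]

lemma runCount_append_congr {t t' : ℝ} {l m : List ℝ} (L : List ℝ)
    (h : ∀ b, runCount t t' b l = runCount t t' b m) (b : Bool) :
    runCount t t' b (L ++ l) = runCount t t' b (L ++ m) := by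
  rw [runCount_append, runCount_append, h]

/-- A sample `u ≤ t'` separates nothing, and a neighbour not above it represents the same component
whenever `u` does. Dually, a sample `u > t` represents nothing, and a neighbour not below it
separates whenever `u` does. Either way `u` is redundant. -/
lemma runCount_skip_of_le_right {t t' u r : ℝ} (h : r ≤ u) (hu : u ≤ t') (R : List ℝ) (b : Bool) :
    runCount t t' b (u :: r :: R) = runCount t t' b (r :: R) := by
  have h1 : ¬ t' < u := not_lt.2 hu
  have h2 : ¬ t' < r := not_lt.2 (h.trans hu)
  by_cases h3 : u ≤ t
  · simp [runCount, h3, h.trans h3]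
  · simp [runCount, h1, h2, h3]

lemma runCount_skip_of_right_ge {t t' u r : ℝ} (h : u ≤ r) (hu : t < u) (R : List ℝ) (b : Bool) :
    runCount t t' b (u :: r :: R) = runCount t t' b (r :: R) := by
  have h1 : ¬ u ≤ t := not_le.2 hu
  have h2 : ¬ r ≤ t := not_le.2 (hu.trans_le h)
  by_cases h3 : t' < u
  · simp [runCount, h1, h2, h3, h3.trans_le h]
  · simp [runCount, h1, h2, h3]

lemma runCount_skip_of_left_le {t t' u p : ℝ} (h : p ≤ u) (hu : u ≤ t') (R : List ℝ) (b : Bool) :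
    runCount t t' b (p :: u :: R) = runCount t t' b (p :: R) := by
  have h1 : ¬ t' < u := not_lt.2 hu
  have h2 : ¬ t' < p := not_lt.2 (h.trans hu)
  by_cases h3 : u ≤ t
  · simp [runCount, h3, h.trans h3]
  · by_cases h4 : p ≤ t <;> simp [runCount, h1, h2, h3, h4]

lemma runCount_skip_of_le_left {t t' u p : ℝ} (h : u ≤ p) (hu : t < u) (R : List ℝ) (b : Bool) :
    runCount t t' b (p :: u :: R) = runCount t t' b (p :: R) := by
  have h1 : ¬ u ≤ t := not_le.2 hu
  have h2 : ¬ p ≤ t := not_le.2 (hu.trans_le h)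
  by_cases h3 : t' < u
  · simp [runCount, h1, h2, h3, h3.trans_le h]
  · by_cases h4 : t' < p <;> simp [runCount, h1, h2, h3, h4]

lemma Drops.diagram_eq {s s' : List ℝ} (h : Drops s s') : diagram s = diagram s' := by
  cases h with
  | head p u R h =>
    refine diagram_eq_of_runCount_eq (by simp) (by simp)
      (diagram_essential_eq (by simp) (by simp +contextual) ?_) fun t t' ht => ?_
    · intro x hx
      rcases List.mem_cons.1 hx with rfl | hx
      · exact ⟨u, by simp, h⟩
      · exact ⟨x, hx, le_rfl⟩
    · simp only [runCount]
      split_ifs <;> first | rfl | omega | (exfalso; linarith)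
  | last L u p h =>
    refine diagram_eq_of_runCount_eq (by simp) (by simp)
      (diagram_essential_eq (by simp) (by simp +contextual [or_imp]) ?_) fun t t' ht => ?_
    · intro x hx
      simp only [List.mem_append, List.mem_cons, List.not_mem_nil, or_false] at hx
      rcases hx with hx | rfl | rfl
      · exact ⟨x, by simp [hx], le_rfl⟩
      · exact ⟨x, by simp, le_rfl⟩
      · exact ⟨u, by simp, h⟩
    · simp only [runCount_append, runCount]
      cases runFlag t t' false L <;> split_ifs <;> first | rfl | omega | (exfalso; linarith)
  | mid L p u r R h =>
    refine diagram_eq_of_runCount_eq (by simp) (by simp)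
      (diagram_essential_eq (by simp) (by simp +contextual [or_imp]) ?_) fun t t' ht => ?_
    · intro x hx
      simp only [List.mem_append, List.mem_cons] at hx
      rcases hx with hx | rfl | rfl | rfl | hx
      · exact ⟨x, by simp [hx], le_rfl⟩
      · exact ⟨x, by simp, le_rfl⟩
      · rcases h with h | h
        · exact ⟨p, by simp, h.1⟩
        · exact ⟨r, by simp, h.1⟩
      · exact ⟨x, by simp, le_rfl⟩
      · exact ⟨x, by simp [hx], le_rfl⟩
    · refine runCount_append_congr L (fun b => ?_) _
      rcases h with ⟨h1, h2⟩ | ⟨h1, h2⟩ <;> rcases lt_or_ge t u with h3 | h3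
      · exact runCount_cons_congr p (runCount_skip_of_right_ge h2 h3 R) b
      · exact runCount_skip_of_left_le h1 (h3.trans ht) _ b
      · exact runCount_skip_of_le_left h2 h3 _ b
      · exact runCount_cons_congr p (runCount_skip_of_le_right h1 (h3.trans ht) R) b

/-- If `u ≤ t` and `t' < v`, then `u` is a component of its own, cut off by `v` on one side and by a
higher sample or the end on the other. If `t < u`, neither sample represents a component; if `v ≤
t'`, neither separates. Then both are redundant. -/
lemma Cancels.diagram_eq {u v : ℝ} {s s' : List ℝ} (h : Cancels u v s s') :
    diagram s = (diagram s').insert (u, v) := by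
  cases h with
  | head r R h h' =>
    refine diagram_eq_insert (by simp) (by simp) h'
      (diagram_essential_eq (by simp) (by simp +contextual) ?_) fun t t' ht => ?_
    · intro x hx
      simp only [List.mem_cons] at hx
      rcases hx with rfl | rfl | hx
      · exact ⟨r, by simp, h⟩
      · exact ⟨r, by simp, h.trans h'⟩
      · exact ⟨x, by simpa using hx, le_rfl⟩
    · by_cases hc : u ≤ t ∧ t' < v
      · have h1 : ¬ v ≤ t := by linarith [hc.2]
        simp only [runCount, hc, h1, if_true, if_false, and_self, Bool.false_eq_true]
      · simp only [hc, if_false, zero_add]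
        rw [not_and_or, not_le, not_lt] at hc
        rcases hc with hc | hc
        · rw [runCount_skip_of_right_ge h' hc]
          simp [runCount, not_le.2 (hc.trans_le h')]
        · rw [runCount_cons_congr u (runCount_skip_of_le_right (h.trans h') hc R),
            runCount_skip_of_le_right h (h'.trans hc)]
  | last L r h h' =>
    refine diagram_eq_insert (by simp) (by simp) h'
      (diagram_essential_eq (by simp) (by simp +contextual [or_imp]) ?_) fun t t' ht => ?_
    · intro x hx
      simp only [List.mem_append, List.mem_cons, List.not_mem_nil, or_false] at hx
      rcases hx with hx | rfl | rfl | rfl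
      · exact ⟨x, by simp [hx], le_rfl⟩
      · exact ⟨x, by simp, le_rfl⟩
      · exact ⟨r, by simp, h.trans h'⟩
      · exact ⟨r, by simp, h⟩
    · by_cases hc : u ≤ t ∧ t' < v
      · have h1 : ¬ v ≤ t := by linarith [hc.2]
        have h2 : r ≤ t := h.trans hc.1
        simp only [runCount_append, runCount, hc, h1, h2, if_true, if_false, and_self,
          Bool.false_eq_true]
        omega
      · simp only [hc, if_false, zero_add]
        rw [not_and_or, not_le, not_lt] at hc
        refine runCount_append_congr L (fun b => ?_) _
        rcases hc with hc | hc
        · rw [runCount_cons_congr r (runCount_skip_of_le_left h' hc [])]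
          simp [runCount, not_le.2 (hc.trans_le h')]
        · rw [runCount_skip_of_left_le (h.trans h') hc, runCount_skip_of_left_le h (h'.trans hc)]
  | desc L p r R h h' h'' =>
    refine diagram_eq_insert (by simp) (by simp) h'
      (diagram_essential_eq (by simp) (by simp +contextual [or_imp]) ?_) fun t t' ht => ?_
    · intro x hx
      simp only [List.mem_append, List.mem_cons] at hx
      rcases hx with hx | rfl | rfl | rfl | rfl | hx
      · exact ⟨x, by simp [hx], le_rfl⟩
      · exact ⟨x, by simp, le_rfl⟩
      · exact ⟨r, by simp, h⟩
      · exact ⟨r, by simp, h.trans h'⟩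
      · exact ⟨x, by simp, le_rfl⟩
      · exact ⟨x, by simp [hx], le_rfl⟩
    · by_cases hc : u ≤ t ∧ t' < v
      · have h1 : ¬ v ≤ t := by linarith [hc.2]
        have h2 : r ≤ t := h.trans hc.1
        have h3 : t' < p := hc.2.trans_le h''
        have h4 : ¬ p ≤ t := by linarith
        simp only [runCount_append, runCount, hc, h1, h2, h3, h4, if_true, if_false, and_self,
          Bool.false_eq_true]
        omega
      · simp only [hc, if_false, zero_add]
        rw [not_and_or, not_le, not_lt] at hc
        refine runCount_append_congr L (fun b => ?_) _
        rcases hc with hc | hc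
        · rw [runCount_skip_of_le_left (h'.trans h'') hc,
            runCount_skip_of_le_left h'' (hc.trans_le h')]
        · rw [runCount_cons_congr p (runCount_cons_congr u
              (runCount_skip_of_le_right (h.trans h') hc R)),
            runCount_cons_congr p (runCount_skip_of_le_right h (h'.trans hc) R)]
  | asc L p r R h h' h'' =>
    refine diagram_eq_insert (by simp) (by simp) h'
      (diagram_essential_eq (by simp) (by simp +contextual [or_imp]) ?_) fun t t' ht => ?_
    · intro x hx
      simp only [List.mem_append, List.mem_cons] at hx
      rcases hx with hx | rfl | rfl | rfl | rfl | hx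
      · exact ⟨x, by simp [hx], le_rfl⟩
      · exact ⟨x, by simp, le_rfl⟩
      · exact ⟨p, by simp, h.trans h'⟩
      · exact ⟨p, by simp, h⟩
      · exact ⟨x, by simp, le_rfl⟩
      · exact ⟨x, by simp [hx], le_rfl⟩
    · by_cases hc : u ≤ t ∧ t' < v
      · have h1 : ¬ v ≤ t := by linarith [hc.2]
        have h2 : p ≤ t := h.trans hc.1
        have h3 : t' < r := hc.2.trans_le h''
        have h4 : ¬ r ≤ t := by linarith
        simp only [runCount_append, runCount, hc, h1, h2, h3, h4, if_true, if_false, and_self,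
          Bool.false_eq_true]
        omega
      · simp only [hc, if_false, zero_add]
        rw [not_and_or, not_le, not_lt] at hc
        refine runCount_append_congr L (fun b => ?_) _
        rcases hc with hc | hc
        · rw [runCount_cons_congr p (runCount_cons_congr v
              (runCount_skip_of_right_ge (h'.trans h'') hc R)),
            runCount_cons_congr p (runCount_skip_of_right_ge h'' (hc.trans_le h') R)]
        · rw [runCount_skip_of_left_le (h.trans h') hc, runCount_skip_of_left_le h (h'.trans hc)]

/-- A list can be shortened by one of the reductions. -/
def Reduces {α : Type*} [LE α] (l : List α) : Prop :=
  (∃ l', Drops l l') ∨ ∃ u v l', Cancels u v l l'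

/-- The step from `y` to `z` is no longer than the one before it. If the next step continues in its
direction, `z` is dropped; if it turns back and reaches past `y`, the pair `y, z` is cancelled;
otherwise the steps shrink again and the induction goes on to the end of the list, where an end
reduction applies. -/
lemma reducible_of_btw {α : Type*} [Preorder α] : ∀ (R L : List α) (x y z : α),
    (∀ a ∈ x :: y :: z :: R, ∀ b ∈ x :: y :: z :: R, a ≤ b ∨ b ≤ a) → Btw x z y →
    Reduces (L ++ x :: y :: z :: R) := by
  intro R
  induction R with
  | nil =>
    intro L x y z htot hz
    rcases htot y (by simp) z (by simp) with h | h
    · left; exact ⟨_, by simpa using Drops.last (L ++ [x]) y z h⟩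
    · rcases hz with hz | hz
      · right; exact ⟨z, y, _, .last L x hz.1 hz.2⟩
      · left; exact ⟨_, by simpa using Drops.last (L ++ [x]) y z hz.1⟩
  | cons w R ih =>
    intro L x y z htot hz
    have next : Btw y w z → Reduces (L ++ x :: y :: z :: w :: R) := by
      intro hw
      simpa using ih (L ++ [x]) y z w (fun a ha b hb => htot a (List.mem_cons_of_mem _ ha) b
        (List.mem_cons_of_mem _ hb)) hw
    have drop : Btw y z w → Reduces (L ++ x :: y :: z :: w :: R) := by
      intro hw
      left; exact ⟨_, by simpa using Drops.mid (L ++ [x]) y z w R hw⟩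
    rcases htot z (by simp) w (by simp) with h1 | h1 <;>
      rcases htot y (by simp) w (by simp) with h2 | h2 <;> rcases hz with hz | hz
    · right; exact ⟨z, y, _, .asc L x w R hz.1 hz.2 h2⟩
    · exact drop (Or.inl ⟨hz.1, h1⟩)
    · exact next (Or.inr ⟨h1, h2⟩)
    · exact drop (Or.inl ⟨hz.1, h1⟩)
    · exact drop (Or.inr ⟨h1, hz.2⟩)
    · exact next (Or.inl ⟨h2, h1⟩)
    · exact drop (Or.inr ⟨h1, hz.2⟩)
    · right; exact ⟨y, z, _, .desc L x w R h2 hz.1 hz.2⟩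

lemma reducible_of_chain {α : Type*} [Preorder α] (x y : α) (R : List α)
    (htot : ∀ a ∈ x :: y :: R, ∀ b ∈ x :: y :: R, a ≤ b ∨ b ≤ a) : Reduces (x :: y :: R) := by
  rcases htot x (by simp) y (by simp) with h | h
  · cases R with
    | nil => left; exact ⟨_, .last [] x y h⟩
    | cons z R =>
      rcases htot y (by simp) z (by simp) with h1 | h1
      · left; exact ⟨_, .mid [] x y z R (Or.inl ⟨h, h1⟩)⟩
      · rcases htot x (by simp) z (by simp) with h2 | h2
        · exact reducible_of_btw R [] x y z htot (Or.inl ⟨h2, h1⟩)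
        · right; exact ⟨x, y, _, .head z R h2 h⟩
  · left; exact ⟨_, .head x y R h⟩

lemma Drops.sublist {α : Type*} [LE α] {l l' : List α} (h : Drops l l') :
    l' ≠ [] ∧ l'.length < l.length ∧ l'.Sublist l := by
  cases h with
  | head p u R h => simp
  | last L u p h => simp
  | mid L p u r R h => simp

lemma Cancels.sublist {α : Type*} [LE α] {u v : α} {l l' : List α} (h : Cancels u v l l') :
    l' ≠ [] ∧ l'.length < l.length ∧ l'.Sublist l := by
  cases h with
  | head r R h h' => simp
  | last L r h h' => simp
  | desc L p r R h h' h'' => simp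
  | asc L p r R h h' h'' => simp

lemma Drops.sum_le {α : Type*} [LE α] {l l' : List α} (h : Drops l l') (f : α → ℝ)
    (hf : ∀ a, 0 ≤ f a) : (l'.map f).sum ≤ (l.map f).sum := by
  cases h with
  | head p u R h => simpa using hf p
  | last L u p h => simpa using hf p
  | mid L p u r R h => simpa using hf u

lemma Cancels.sum_eq {α : Type*} [LE α] {u v : α} {l l' : List α} (h : Cancels u v l l')
    (f : α → ℝ) : (l.map f).sum = f u + f v + (l'.map f).sum := by
  cases h <;> simp <;> ring

/-! ### Stability under changes of the samples -/

/-- Two lists of the same length whose entries are ordered in the same way (up to ties) have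
diagrams whose distance is at most the `ℓ¹` distance of the lists. -/
lemma close_of_chain : ∀ (n : ℕ) (l : List (ℝ × ℝ)), l.length = n → l ≠ [] →
    (∀ a ∈ l, ∀ b ∈ l, a ≤ b ∨ b ≤ a) →
    Close (l.map (fun z => |z.1 - z.2|)).sum (diagram (l.map Prod.fst))
      (diagram (l.map Prod.snd)) := by
  intro n
  induction n using Nat.strong_induction_on with
  | _ n ih =>
    intro l hn hl htot
    match l, hl with
    | [z], _ =>
      have hfin : ∀ x : ℝ, diagram [x] = ⟨0, {x}⟩ := by
        intro x
        have ho : ∀ i : Fin [x].length, ¬ ∃ j, Older [x] j i := by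
          rintro i ⟨j, hj⟩
          have hi : i = 0 := Subsingleton.elim (α := Fin 1) _ _
          have hj' : j = 0 := Subsingleton.elim (α := Fin 1) _ _
          subst hi hj'
          exact Older.irrefl _ _ hj
        simp only [diagram, ho]
        simp
      refine ⟨0, {z}, ?_⟩
      simp [hfin]
    | x :: y :: R, _ =>
      rcases reducible_of_chain x y R htot with ⟨l', h⟩ | ⟨u, v, l', h⟩
      · obtain ⟨h1, h2, h3⟩ := h.sublist
        rw [(h.map monotone_fst).diagram_eq, (h.map monotone_snd).diagram_eq]
        exact (ih _ (hn ▸ h2) l' rfl h1 fun a ha b hb =>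
          htot a (h3.subset ha) b (h3.subset hb)).mono (h.sum_le _ fun _ => abs_nonneg _)
      -- The two deleted points are matched with each other; their `taxi` distance is exactly the
      -- contribution of the two cancelled samples.
      · obtain ⟨h1, h2, h3⟩ := h.sublist
        rw [(h.map monotone_fst).diagram_eq, (h.map monotone_snd).diagram_eq, h.sum_eq]
        exact (ih _ (hn ▸ h2) l' rfl h1 fun a ha b hb =>
          htot a (h3.subset ha) b (h3.subset hb)).insert _ _

lemma close_refl (s : List ℝ) (hs : s ≠ []) : Close 0 (diagram s) (diagram s) := by
  have := close_of_chain _ (s.map fun x => (x, x)) rfl (by simpa) (by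
    intro a ha b hb
    obtain ⟨x, -, rfl⟩ := List.mem_map.1 ha
    obtain ⟨y, -, rfl⟩ := List.mem_map.1 hb
    simpa using le_total x y)
  simpa [Function.comp_def] using this

open Classical in
/-- Moving a single sample. -/
lemma close_move_one : ∀ (n : ℕ) (L R : List ℝ) (u v : ℝ),
    ((L ++ R).toFinset.filter (fun w => min u v < w ∧ w < max u v)).card = n →
    Close |u - v| (diagram (L ++ u :: R)) (diagram (L ++ v :: R)) := by
  intro n
  induction n using Nat.strong_induction_on with
  | _ n ih =>
    intro L R u v hn
    by_cases hw : ∃ w ∈ L ++ R, min u v < w ∧ w < max u v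
    · obtain ⟨w, hw, h1, h2⟩ := hw
      have lt_of : ∀ u' v' : ℝ, min u v ≤ min u' v' → max u' v' ≤ max u v →
          (w ≤ min u' v' ∨ max u' v' ≤ w) →
          ((L ++ R).toFinset.filter (fun w => min u' v' < w ∧ w < max u' v')).card < n := by
        intro u' v' h3 h4 h5
        rw [← hn]
        refine Finset.card_lt_card ⟨fun a ha => ?_, fun hs => ?_⟩
        · rw [Finset.mem_filter] at ha ⊢
          exact ⟨ha.1, h3.trans_lt ha.2.1, ha.2.2.trans_le h4⟩
        · have := (Finset.mem_filter.1 (hs (Finset.mem_filter.2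
            ⟨List.mem_toFinset.2 hw, h1, h2⟩))).2
          rcases h5 with h5 | h5
          · exact absurd this.1 (not_lt.2 h5)
          · exact absurd this.2 (not_lt.2 h5)
      have e1 := ih _ (lt_of u w (le_min (min_le_left _ _) h1.le)
        (max_le (le_max_left _ _) h2.le) ((le_total u w).elim (fun h => Or.inr (max_le h le_rfl))
          fun h => Or.inl (le_min h le_rfl))) L R u w rfl
      have e2 := ih _ (lt_of w v (le_min h1.le (min_le_right _ _))
        (max_le h2.le (le_max_right _ _)) ((le_total w v).elim (fun h => Or.inl (le_min le_rfl h))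
          fun h => Or.inr (max_le le_rfl h))) L R w v rfl
      refine (e1.trans e2).mono (le_of_eq ?_)
      rcases le_total u v with h | h
      · simp only [min_eq_left h, max_eq_right h] at h1 h2
        rw [abs_of_nonpos, abs_of_nonpos, abs_of_nonpos] <;> linarith
      · simp only [min_eq_right h, max_eq_left h] at h1 h2
        rw [abs_of_nonneg, abs_of_nonneg, abs_of_nonneg] <;> linarith
    -- No other value lies strictly between `u` and `v`, so `(u, v)` and the pairs `(w, w)` form a
    -- chain.
    · have hc : ∀ w ∈ L ++ R, (w ≤ u ∧ w ≤ v) ∨ (u ≤ w ∧ v ≤ w) := by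
        intro w hw'
        by_contra! h
        refine hw ⟨w, hw', ?_⟩
        rcases le_total u v with h3 | h3
        · simp only [min_eq_left h3, max_eq_right h3]
          constructor
          · by_contra! h4; exact absurd (h.1 h4) (not_lt.2 (h4.trans h3))
          · by_contra! h4; exact absurd (h.2 (h3.trans h4)) (not_lt.2 h4)
        · simp only [min_eq_right h3, max_eq_left h3]
          constructor
          · by_contra! h4; exact absurd (h.1 (h4.trans h3)) (not_lt.2 h4)
          · by_contra! h4; exact absurd (h.2 h4) (not_lt.2 (h3.trans h4))
      have := close_of_chain _ (L.map (fun x => (x, x)) ++ (u, v) :: R.map fun x => (x, x)) rfl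
        (by simp) (by
          intro a ha b hb
          have hm : ∀ a ∈ (L.map (fun x => (x, x)) ++ (u, v) :: R.map fun x => (x, x)),
              a = (u, v) ∨ ∃ w ∈ L ++ R, a = (w, w) := by
            intro a ha
            simp only [List.mem_append, List.mem_cons, List.mem_map] at ha ⊢
            rcases ha with ⟨w, hw, rfl⟩ | rfl | ⟨w, hw, rfl⟩
            · exact Or.inr ⟨w, Or.inl hw, rfl⟩
            · exact Or.inl rfl
            · exact Or.inr ⟨w, Or.inr hw, rfl⟩
          rcases hm a ha with rfl | ⟨w, hw, rfl⟩ <;> rcases hm b hb with rfl | ⟨w', hw', rfl⟩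
          · exact Or.inl le_rfl
          · exact (hc w' hw').symm
          · exact hc w hw
          · simpa using le_total w w')
      simpa [Function.comp_def] using this

lemma close_move (L R : List ℝ) (u v : ℝ) :
    Close |u - v| (diagram (L ++ u :: R)) (diagram (L ++ v :: R)) := by
  classical
  exact close_move_one _ L R u v rfl

/-- Stability of the diagram, for lists of the same length. -/
lemma close_map : ∀ (l : List (ℝ × ℝ)) (L : List ℝ), L ++ l.map Prod.fst ≠ [] →
    Close (l.map (fun z => |z.1 - z.2|)).sum (diagram (L ++ l.map Prod.fst))
      (diagram (L ++ l.map Prod.snd)) := by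
  intro l
  induction l with
  | nil => intro L hL; simpa using close_refl L (by simpa using hL)
  | cons z l ih =>
    intro L hL
    have h1 := close_move L (l.map Prod.fst) z.1 z.2
    have h2 := ih (L ++ [z.2]) (by simp)
    simpa using h1.trans (by simpa using h2)

/-! ### Removal of runs of consecutive pairs -/

/-- The list of the entries of a list of pairs. -/
def flat {α : Type*} (ps : List (α × α)) : List α := ps.flatMap fun z => [z.1, z.2]

@[simp] lemma flat_nil {α : Type*} : flat ([] : List (α × α)) = [] := rfl

@[simp] lemma flat_cons {α : Type*} (z : α × α) (ps : List (α × α)) :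
    flat (z :: ps) = z.1 :: z.2 :: flat ps := by simp [flat]

/-- The first entry of the list `flat ps ++ [r]`. -/
def next {α : Type*} (r : α) : List (α × α) → α
  | [] => r
  | z :: _ => z.1

lemma flat_append_eq_next {α : Type*} (ps : List (α × α)) (r : α) (R : List α) :
    ∃ R', flat ps ++ r :: R = next r ps :: R' := by
  cases ps with
  | nil => exact ⟨R, rfl⟩
  | cons z ps => exact ⟨z.2 :: flat ps ++ r :: R, by simp [next]⟩

section Run

variable {α : Type*} [LinearOrder α]

/-- The list `p :: flat ps ++ [r]` goes down, up, down, ..., down. -/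
def Wave (r : α) : α → List (α × α) → Prop
  | p, [] => r ≤ p
  | p, z :: ps => z.1 ≤ p ∧ z.1 ≤ z.2 ∧ Wave r z.2 ps

lemma Wave.next_le {r p : α} {ps : List (α × α)} (h : Wave r p ps) : next r ps ≤ p := by
  cases ps with
  | nil => exact h
  | cons z ps => exact h.1

lemma Wave.of_next_le {r p q : α} {ps : List (α × α)} (h : Wave r q ps) (hp : next r ps ≤ p) :
    Wave r p ps := by
  cases ps with
  | nil => exact hp
  | cons z ps => exact ⟨hp, h.2⟩

/-- All pairs of `ps` can be collapsed, from the left to the right, in an increasing way. -/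
def Ascent (r p : α) : List (α × α) → Prop
  | [] => True
  | z :: ps => z.1 ≤ z.2 ∧ p ≤ z.2 ∧ p ≤ next r ps ∧ z.1 ≤ next r ps ∧ Ascent r p ps

lemma Ascent.mono {r p q : α} (hpq : p ≤ q) {ps : List (α × α)} (h : Ascent r q ps) :
    Ascent r p ps := by
  induction ps with
  | nil => trivial
  | cons z ps ih =>
    obtain ⟨h1, h2, h3, h4, h5⟩ := h
    exact ⟨h1, hpq.trans h2, hpq.trans h3, h4, ih h5⟩

/-- In a wave one pair can be collapsed so that a wave is left, or the wave is an ascent. -/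
lemma Wave.exists_collapse_or_ascent {r : α} : ∀ {ps : List (α × α)} {p : α}, Wave r p ps →
    (∃ ps₁ z ps₂ M q v, ps = ps₁ ++ z :: ps₂ ∧ Wave r p (ps₁ ++ ps₂) ∧
      p :: flat ps₁ = M ++ [q] ∧ z.1 ≤ v ∧ v ≤ z.2 ∧ Btw q v (next r ps₂)) ∨ Ascent r p ps := by
  intro ps
  induction ps with
  | nil => exact fun _ => Or.inr trivial
  | cons z ps ih =>
    rintro p ⟨h1, h2, h3⟩
    -- If the next entry is at most `p`, collapsing the first pair leaves a wave, and the intervals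
    -- `[z.1, z.2]` and `[next r ps, p]` meet in `max z.1 (next r ps)`. Otherwise the tail decides;
    -- if it is an ascent from `z.2`, it is one from the smaller `p`.
    rcases le_total (next r ps) p with h | h
    · exact Or.inl ⟨[], z, ps, [], p, max z.1 (next r ps), rfl, h3.of_next_le h, rfl,
        le_max_left _ _, max_le h2 h3.next_le, Or.inr ⟨le_max_right _ _, max_le h1 h⟩⟩
    · rcases ih h3 with ⟨ps₁, y, ps₂, M, q, v, rfl, h4, h5, h6⟩ | h4
      · exact Or.inl ⟨z :: ps₁, y, ps₂, p :: z.1 :: M, q, v, rfl, ⟨h1, h2, h4⟩, by simp [h5], h6⟩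
      · exact Or.inr ⟨h2, h.trans h3.next_le, h, h1.trans h, h4.mono (h.trans h3.next_le)⟩

variable {P : List α → List α → ℝ → Prop} {d : α → α → ℝ}
  (hrefl : ∀ L p R, P (L ++ p :: R) (L ++ p :: R) 0)
  (htrans : ∀ {l m n c c'}, P l m c → P m n c' → P l n (c + c'))
  (hcollapse : ∀ L p x y r R v, x ≤ v → v ≤ y → Btw p v r →
    P (L ++ p :: x :: y :: r :: R) (L ++ p :: r :: R) (d x y))

include hrefl htrans hcollapse

/-- Here the left neighbour stays `p` throughout, and `max p z.1` lies in both `[z.1, z.2]` and `[p,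
next r ps]`. -/
lemma Ascent.collapse {r p : α} (L R : List α) : ∀ {ps : List (α × α)}, Ascent r p ps →
    P (L ++ p :: (flat ps ++ r :: R)) (L ++ p :: r :: R) (ps.map fun z => d z.1 z.2).sum := by
  intro ps
  induction ps with
  | nil => intro _; exact hrefl L p (r :: R)
  | cons z ps ih =>
    rintro ⟨h1, h2, h3, h4, h5⟩
    obtain ⟨R', hR'⟩ := flat_append_eq_next ps r R
    have key := hcollapse L p z.1 z.2 (next r ps) R' (max p z.1) (le_max_right _ _)
      (max_le h2 h1) (Or.inl ⟨le_max_left _ _, max_le h3 h4⟩)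
    rw [← hR'] at key
    simpa using htrans key (ih h5)

lemma Wave.collapse {r p : α} (L R : List α) : ∀ (n : ℕ) {ps : List (α × α)}, ps.length = n →
    Wave r p ps →
    P (L ++ p :: (flat ps ++ r :: R)) (L ++ p :: r :: R) (ps.map fun z => d z.1 z.2).sum := by
  intro n
  induction n with
  | zero =>
    intro ps hn _
    rw [List.length_eq_zero_iff] at hn
    subst hn
    exact hrefl L p (r :: R)
  | succ n ih =>
    intro ps hn h
    rcases h.exists_collapse_or_ascent with ⟨ps₁, z, ps₂, M, q, v, rfl, h4, h5, h6, h7, h8⟩ | h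
    · obtain ⟨R', hR'⟩ := flat_append_eq_next ps₂ r R
      have key := hcollapse (L ++ M) q z.1 z.2 (next r ps₂) R' v h6 h7 h8
      rw [← hR'] at key
      have e1 : L ++ p :: (flat (ps₁ ++ z :: ps₂) ++ r :: R) =
          L ++ M ++ q :: z.1 :: z.2 :: (flat ps₂ ++ r :: R) := by
        have : L ++ p :: (flat (ps₁ ++ z :: ps₂) ++ r :: R) =
          L ++ (p :: flat ps₁) ++ z.1 :: z.2 :: (flat ps₂ ++ r :: R) := by simp [flat]
        rw [this, h5]; simp
      have e2 : L ++ p :: (flat (ps₁ ++ ps₂) ++ r :: R) =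
          L ++ M ++ q :: (flat ps₂ ++ r :: R) := by
        have : L ++ p :: (flat (ps₁ ++ ps₂) ++ r :: R) =
          L ++ (p :: flat ps₁) ++ (flat ps₂ ++ r :: R) := by simp [flat]
        rw [this, h5]; simp
      rw [← e1, ← e2] at key
      have := htrans key (ih (by simp at hn ⊢; omega) h4)
      simp only [List.map_append, List.sum_append, List.map_cons, List.sum_cons] at this ⊢
      convert this using 1; ring
    · exact h.collapse hrefl htrans hcollapse L R

end Run

lemma close_collapse (L : List ℝ) (p x y r : ℝ) (R : List ℝ) (v : ℝ) (hv : Btw x v y)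
    (h : Btw p v r) :
    Close |x - y| (diagram (L ++ p :: x :: y :: r :: R)) (diagram (L ++ p :: r :: R)) := by
  have h1 := close_move (L ++ [p]) (y :: r :: R) x v
  have h2 := close_move (L ++ [p, v]) (r :: R) y v
  simp only [List.append_assoc, List.cons_append, List.nil_append] at h1 h2
  have h3 : Drops (L ++ p :: v :: v :: r :: R) (L ++ p :: v :: r :: R) :=
    .mid L p v v (r :: R) (h.imp (fun h => ⟨h.1, le_rfl⟩) (fun h => ⟨le_rfl, h.2⟩))
  have h4 := Drops.mid L p v r R h
  rw [h3.diagram_eq, h4.diagram_eq] at h2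
  refine (h1.trans h2).mono (le_of_eq ?_)
  rcases hv with hv | hv
  · rw [abs_of_nonpos (by linarith), abs_of_nonneg (by linarith), abs_of_nonpos (by linarith)]
    ring
  · rw [abs_of_nonneg (by linarith), abs_of_nonpos (by linarith), abs_of_nonneg (by linarith)]
    ring

lemma Wave.close {r p : ℝ} (L R : List ℝ) {ps : List (ℝ × ℝ)} (h : Wave r p ps) :
    Close (ps.map fun z => |z.1 - z.2|).sum (diagram (L ++ p :: (flat ps ++ r :: R)))
      (diagram (L ++ p :: r :: R)) :=
  Wave.collapse (P := fun l m c => Close c (diagram l) (diagram m)) (d := fun x y => |x - y|)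
    (fun L p R => close_refl _ (by simp)) Close.trans
    (fun L p x y r R v h1 h2 h3 => close_collapse L p x y r R v (Or.inl ⟨h1, h2⟩) h3) L R _ rfl h

/-- Betweenness and `|x - y|` are insensitive to reversing the order, so runs that start upwards are
waves in `ℝᵒᵈ`. -/
lemma Wave.close_dual {r p : ℝ} (L R : List ℝ) {ps : List (ℝ × ℝ)}
    (h : Wave (α := ℝᵒᵈ) r p ps) :
    Close (ps.map fun z => |z.1 - z.2|).sum (diagram (L ++ p :: (flat ps ++ r :: R)))
      (diagram (L ++ p :: r :: R)) :=
  Wave.collapse (α := ℝᵒᵈ) (P := fun l m c => Close c (diagram l) (diagram m))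
    (d := fun x y : ℝ => |x - y|)
    (fun _ _ _ => close_refl _ (List.append_ne_nil_of_right_ne_nil _ (List.cons_ne_nil _ _)))
    Close.trans
    (fun L p x y r R v h1 h2 h3 => close_collapse L p x y r R v (Or.inr ⟨h2, h1⟩)
      (h3.elim (fun h => Or.inr ⟨h.2, h.1⟩) fun h => Or.inl ⟨h.2, h.1⟩))
    L R _ rfl h

/-- `Removal l l' c`: the list `l'` arises from `l` by the removal of disjoint pairs of consecutive
elements, of total length `c`. -/
inductive Removal : List ℝ → List ℝ → ℝ → Prop
  | nil : Removal [] [] 0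
  | keep (x : ℝ) {l l' : List ℝ} {c : ℝ} (h : Removal l l' c) : Removal (x :: l) (x :: l') c
  | skip (x y : ℝ) {l l' : List ℝ} {c : ℝ} (h : Removal l l' c) :
      Removal (x :: y :: l) l' (|x - y| + c)

lemma Removal.exists_run {l l' : List ℝ} {c : ℝ} (h : Removal l l' c) :
    ∃ ps : List (ℝ × ℝ),
      (l = flat ps ∧ l' = [] ∧ c = (ps.map fun z => |z.1 - z.2|).sum) ∨
      ∃ r l₁ l₁' c₁, l = flat ps ++ r :: l₁ ∧ l' = r :: l₁' ∧ Removal l₁ l₁' c₁ ∧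
        c = (ps.map fun z => |z.1 - z.2|).sum + c₁ := by
  induction h with
  | nil => exact ⟨[], Or.inl (by simp)⟩
  | keep x h _ => exact ⟨[], Or.inr ⟨x, _, _, _, by simp, rfl, h, by simp⟩⟩
  | skip x y h ih =>
    obtain ⟨ps, ⟨rfl, rfl, rfl⟩ | ⟨r, l₁, l₁', c₁, rfl, rfl, h1, rfl⟩⟩ := ih
    · exact ⟨(x, y) :: ps, Or.inl (by simp)⟩
    · exact ⟨(x, y) :: ps, Or.inr ⟨r, l₁, l₁', c₁, by simp, rfl, h1, by simp [add_assoc]⟩⟩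

/-- The list alternates between steps upwards and downwards; the flag tells whether the first step
goes upwards. -/
def Zigzag : Bool → List ℝ → Prop
  | _, [] => True
  | _, [_] => True
  | up, x :: y :: l => (if up then x ≤ y else y ≤ x) ∧ Zigzag (!up) (y :: l)

lemma Zigzag.wave {r : ℝ} {R : List ℝ} : ∀ {ps : List (ℝ × ℝ)} {p : ℝ},
    Zigzag false (p :: (flat ps ++ r :: R)) → Wave r p ps ∧ Zigzag true (r :: R) := by
  intro ps
  induction ps with
  | nil => intro p h; simpa [Wave, Zigzag] using h
  | cons z ps ih =>
    intro p h
    simp only [flat_cons, List.cons_append, Zigzag] at h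
    obtain ⟨h1, h2, h3⟩ := h
    obtain ⟨h4, h5⟩ := ih h3
    exact ⟨⟨by simpa using h1, by simpa using h2, h4⟩, h5⟩

lemma Zigzag.wave_dual {r : ℝ} {R : List ℝ} : ∀ {ps : List (ℝ × ℝ)} {p : ℝ},
    Zigzag true (p :: (flat ps ++ r :: R)) → Wave (α := ℝᵒᵈ) r p ps ∧ Zigzag false (r :: R) := by
  intro ps
  induction ps with
  | nil =>
    intro p h
    have h1 : p ≤ r := by simpa [Zigzag] using h.1
    exact ⟨h1, by simpa using h.2⟩
  | cons z ps ih =>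
    intro p h
    simp only [flat_cons, List.cons_append, Zigzag] at h
    obtain ⟨h1, h2, h3⟩ := h
    obtain ⟨h4, h5⟩ := ih h3
    simp only [if_true, Bool.not_true, Bool.false_eq_true, if_false] at h1 h2
    exact ⟨⟨h1, h2, h4⟩, h5⟩

/-- A run of pairs has an even number of entries, so the steps leaving `p` and reaching `r` have the
same direction: the run is a wave or a dual wave, and the next step turns. -/
lemma Zigzag.close {up : Bool} {r p : ℝ} (L R : List ℝ) {ps : List (ℝ × ℝ)}
    (h : Zigzag up (p :: (flat ps ++ r :: R))) :
    Close (ps.map fun z => |z.1 - z.2|).sum (diagram (L ++ p :: (flat ps ++ r :: R)))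
      (diagram (L ++ p :: r :: R)) ∧ Zigzag (!up) (r :: R) := by
  cases up with
  | false => exact ⟨h.wave.1.close L R, h.wave.2⟩
  | true => exact ⟨h.wave_dual.1.close_dual L R, h.wave_dual.2⟩

lemma Removal.close (B : ℝ) : ∀ (l' l L : List ℝ) (p c : ℝ) (up : Bool), Removal l l' c →
    Zigzag up (p :: (l ++ [B])) →
    Close c (diagram (L ++ p :: (l ++ [B]))) (diagram (L ++ p :: (l' ++ [B]))) := by
  intro l'
  induction l' with
  | nil =>
    intro l L p c up h hz
    obtain ⟨ps, ⟨rfl, -, rfl⟩ | ⟨r, l₁, l₁', c₁, -, h0, -⟩⟩ := h.exists_run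
    · exact (hz.close L []).1
    · simp at h0
  | cons r l' ih =>
    intro l L p c up h hz
    obtain ⟨ps, ⟨-, h0, -⟩ | ⟨r', l₁, l₁', c₁, rfl, h0, h1, rfl⟩⟩ := h.exists_run
    · simp at h0
    · obtain ⟨rfl, rfl⟩ := List.cons_eq_cons.1 h0
      rw [List.append_assoc, List.cons_append] at hz ⊢
      obtain ⟨h2, h3⟩ := hz.close L (l₁ ++ [B])
      have h4 := ih l₁ (L ++ [p]) r c₁ _ h1 h3
      simpa using h2.trans (by simpa using h4)

/-- Two alternating series from which pairs are removed so that series of the same length remain: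
the distance of the diagrams is bounded by the total cost. -/
lemma close_of_removal {a b : List ℝ} (l : List (ℝ × ℝ)) {ca cb B : ℝ}
    (ha : a ≠ []) (hb : b ≠ []) (haB : ∀ x ∈ a, x ≤ B) (hbB : ∀ x ∈ b, x ≤ B)
    (hza : Zigzag false (B :: (a ++ [B]))) (hzb : Zigzag false (B :: (b ++ [B])))
    (hra : Removal a (l.map Prod.fst) ca) (hrb : Removal b (l.map Prod.snd) cb) :
    Close ((l.map fun z => |z.1 - z.2|).sum + ca + cb) (diagram a) (diagram b) := by
  -- The bound `B` at both ends places every removed run between two kept samples; being at least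
  -- the end samples, it does not affect the diagram.
  have sentinel : ∀ a : List ℝ, a ≠ [] → (∀ x ∈ a, x ≤ B) →
      diagram (B :: (a ++ [B])) = diagram a := by
    intro a ha hB
    obtain ⟨x, a', rfl⟩ := List.exists_cons_of_ne_nil ha
    have h1 : Drops (B :: (x :: a' ++ [B])) (x :: a' ++ [B]) := .head B x _ (hB x (by simp))
    rw [h1.diagram_eq]
    obtain ⟨m, y, hm⟩ : ∃ m y, x :: a' = m ++ [y] :=
      ⟨_, _, (List.dropLast_append_getLast (List.cons_ne_nil x a')).symm⟩
    rw [hm] at hB ⊢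
    have h2 : Drops (m ++ [y] ++ [B]) (m ++ [y]) := by
      simpa using Drops.last m y B (hB y (by simp))
    exact h2.diagram_eq
  have h1 := hra.close B _ _ [] B ca false hza
  have h2 := hrb.close B _ _ [] B cb false hzb
  have h3 := close_map ((B, B) :: (l ++ [(B, B)])) [] (by simp)
  simp only [List.nil_append] at h1 h2 h3
  rw [sentinel a ha haB] at h1
  rw [sentinel b hb hbB] at h2
  have h3' : Close (l.map fun z => |z.1 - z.2|).sum (diagram (B :: (l.map Prod.fst ++ [B])))
      (diagram (B :: (l.map Prod.snd ++ [B]))) := by simpa using h3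
  exact ((h1.trans h3').trans h2.symm).mono (by linarith)

/-! ### Alignments as removals -/

-- `K` marks kept indices and `S` the first indices of removed pairs. Index `0` cannot be second in
-- a pair, so it is kept or starts one, and one or two entries are stripped off.
open Classical in
lemma removal_of_indices : ∀ (n : ℕ) (a : List ℝ) (K S : ℕ → Prop), a.length = n →
    (∀ i < n, K i ∨ S i ∨ ∃ j, j + 1 = i ∧ S j) → (∀ i, K i → ¬ S i) →
    (∀ i, S i → ¬ K (i + 1) ∧ ¬ S (i + 1) ∧ i + 1 < n) →
    Removal a (((List.range n).filter (fun i => decide (K i))).map (a.getD · 0))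
      (∑ i ∈ Finset.range n, if S i then |a.getD i 0 - a.getD (i + 1) 0| else 0) := by
  intro n
  induction n using Nat.strong_induction_on with
  | _ n ih =>
    intro a K S hn h1 h2 h3
    match a, hn with
    | [], hn =>
      have : n = 0 := by simpa using hn.symm
      subst this
      simpa using Removal.nil
    | x :: l, hn =>
      obtain ⟨m, rfl⟩ : ∃ m, n = m + 1 := ⟨l.length, by simpa using hn.symm⟩
      have hl : l.length = m := by simpa using hn
      by_cases hK : K 0
      · have hS : ¬ S 0 := h2 0 hK
        have := ih m (by omega) l (fun i => K (i + 1)) (fun i => S (i + 1)) hl (by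
          intro i hi
          rcases h1 (i + 1) (by omega) with h | h | ⟨j, hj, h⟩
          · exact Or.inl h
          · exact Or.inr (Or.inl h)
          · obtain rfl : j = i := by omega
            rcases j with _ | j
            · exact absurd h hS
            · exact Or.inr (Or.inr ⟨j, rfl, h⟩)) (fun i => h2 _) (fun i hi => by
              have := h3 _ hi; exact ⟨this.1, this.2.1, by omega⟩)
        have := Removal.keep x this
        rw [Finset.sum_range_succ', List.range_succ_eq_map]
        simpa [hK, hS, List.filter_map, Function.comp_def] using this
      · have hS : S 0 := by
          rcases h1 0 (by omega) with h | h | ⟨j, hj, h⟩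
          · exact absurd h hK
          · exact h
          · omega
        obtain ⟨hK1, hS1, hlt⟩ := h3 0 hS
        match l, hl with
        | [], hl => simp at hl; omega
        | y :: l, hl =>
          obtain ⟨m', rfl⟩ : ∃ m', m = m' + 1 := ⟨l.length, by simpa using hl.symm⟩
          have := ih m' (by omega) l (fun i => K (i + 2)) (fun i => S (i + 2)) (by simpa using hl)
            (by
              intro i hi
              rcases h1 (i + 2) (by omega) with h | h | ⟨j, hj, h⟩
              · exact Or.inl h
              · exact Or.inr (Or.inl h)
              · obtain rfl : j = i + 1 := by omega
                rcases i with _ | i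
                · exact absurd h hS1
                · exact Or.inr (Or.inr ⟨i, rfl, h⟩)) (fun i => h2 _) (fun i hi => by
                  have := h3 _ hi; exact ⟨this.1, this.2.1, by omega⟩)
          have := Removal.skip x y this
          rw [Finset.sum_range_succ', Finset.sum_range_succ', List.range_succ_eq_map,
            List.range_succ_eq_map]
          simp only [zero_add] at hS1 hK1
          rw [add_comm |x - y|] at this
          simpa [hK, hS, hK1, hS1, List.filter_map, Function.comp_def] using this

open Classical in
lemma removal_of_pairs {ι : Type*} (a : List ℝ) (M : Finset ι) (π : ι → Fin a.length)
    (R : Finset (Fin a.length × Fin a.length)) (hR : ∀ p ∈ R, p.1.val + 1 = p.2.val)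
    (h1 : ∀ i, (M.filter (fun p => π p = i)).card +
      (R.filter (fun p => p.1 = i ∨ p.2 = i)).card = 1)
    (l : List ι) (hl : ∀ p, p ∈ l ↔ p ∈ M) (hs : l.Pairwise (fun p q => π p < π q)) :
    Removal a (l.map fun p => a.get (π p)) (∑ p ∈ R, |a.get p.1 - a.get p.2|) := by
  obtain ⟨K, hK⟩ : ∃ K : ℕ → Prop, ∀ i, K i ↔ ∃ p ∈ M, (π p).val = i := ⟨_, fun _ => Iff.rfl⟩
  obtain ⟨S, hS⟩ : ∃ S : ℕ → Prop, ∀ i, S i ↔ ∃ p ∈ R, p.1.val = i := ⟨_, fun _ => Iff.rfl⟩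
  have key := removal_of_indices a.length a K S rfl ?_ ?_ ?_
  · have e1 : ((List.range a.length).filter (fun i => decide (K i))) =
        l.map fun p => (π p).val := by
      refine List.Perm.eq_of_pairwise (le := (· < ·)) (fun a b _ _ h h' => by omega) ?_ ?_ ?_
      · exact List.pairwise_lt_range.filter _
      · rw [List.pairwise_map]; exact hs
      · rw [List.perm_ext_iff_of_nodup]
        · intro i
          simp only [List.mem_filter, List.mem_range, decide_eq_true_eq, List.mem_map, hl, hK]
          refine ⟨fun h => h.2, fun h => ⟨?_, h⟩⟩
          obtain ⟨p, -, rfl⟩ := h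
          exact (π p).2
        · exact List.nodup_range.filter _
        · exact (List.pairwise_map.2 (hs.imp fun {p q} h => (Fin.val_ne_of_ne h.ne)))
    have e2 : (∑ i ∈ Finset.range a.length, if S i then |a.getD i 0 - a.getD (i + 1) 0| else 0) =
        ∑ p ∈ R, |a.get p.1 - a.get p.2| := by
      rw [← Finset.sum_filter]
      have : (Finset.range a.length).filter S = R.image (fun p => p.1.val) := by
        ext i
        simp only [Finset.mem_filter, Finset.mem_range, Finset.mem_image, hS]
        refine ⟨fun h => h.2, fun h => ⟨?_, h⟩⟩
        obtain ⟨p, -, rfl⟩ := h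
        exact p.1.2
      rw [this, Finset.sum_image]
      · refine Finset.sum_congr rfl fun p hp => ?_
        rw [hR p hp, getD_eq_get, getD_eq_get]
      · intro p hp q hq h
        have h2 : p.1 = q.1 := Fin.ext h
        exact Prod.ext h2 (Fin.ext (by rw [← hR p hp, ← hR q hq, h2]))
    rw [e1, e2, List.map_map] at key
    simpa [Function.comp_def] using key
  · intro i hi
    have := h1 ⟨i, hi⟩
    by_cases hM : (M.filter (fun p => π p = ⟨i, hi⟩)).Nonempty
    · obtain ⟨p, hp⟩ := hM
      rw [Finset.mem_filter] at hp
      exact Or.inl ((hK i).2 ⟨p, hp.1, by rw [hp.2]⟩)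
    · rw [Finset.not_nonempty_iff_eq_empty] at hM
      rw [hM, Finset.card_empty, zero_add] at this
      obtain ⟨p, hp⟩ := Finset.card_eq_one.1 this
      replace hp := hp.symm ▸ Finset.mem_singleton_self p
      rw [Finset.mem_filter] at hp
      rcases hp.2 with h | h
      · exact Or.inr (Or.inl ((hS i).2 ⟨p, hp.1, by rw [h]⟩))
      · exact Or.inr (Or.inr ⟨p.1.val, by rw [hR p hp.1, h], (hS _).2 ⟨p, hp.1, rfl⟩⟩)
  · intro i hKi hSi
    obtain ⟨p, hp, rfl⟩ := (hK i).1 hKi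
    obtain ⟨q, hq, hqi⟩ := (hS _).1 hSi
    have := h1 (π p)
    have c1 : 0 < (M.filter (fun p' => π p' = π p)).card :=
      Finset.card_pos.2 ⟨p, by simp [hp]⟩
    have c2 : 0 < (R.filter (fun p' => p'.1 = π p ∨ p'.2 = π p)).card :=
      Finset.card_pos.2 ⟨q, by simp [hq, Fin.ext_iff, hqi]⟩
    omega
  · intro i hSi
    obtain ⟨p, hp, rfl⟩ := (hS i).1 hSi
    have := h1 p.2
    refine ⟨?_, ?_, by rw [hR p hp]; exact p.2.2⟩
    · intro hq0
      obtain ⟨q, hq, hqi⟩ := (hK _).1 hq0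
      rw [hR p hp] at hqi
      have c1 : 0 < (M.filter (fun p' => π p' = p.2)).card :=
        Finset.card_pos.2 ⟨q, by simp [hq, Fin.ext_iff, hqi]⟩
      have c2 : 0 < (R.filter (fun p' => p'.1 = p.2 ∨ p'.2 = p.2)).card :=
        Finset.card_pos.2 ⟨p, by simp [hp]⟩
      omega
    · intro hq0
      obtain ⟨q, hq, hqi⟩ := (hS _).1 hq0
      have hpq : p ≠ q := by rintro rfl; omega
      rw [hR p hp] at hqi
      have c2 : 1 < (R.filter (fun p' => p'.1 = p.2 ∨ p'.2 = p.2)).card :=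
        Finset.one_lt_card.2 ⟨p, by simp [hp], q, by simp [hq, Fin.ext_iff, hqi], hpq⟩
      omega

lemma Alignment.exists_removal {a b : List ℝ} (A : Alignment a b) :
    ∃ (l : List (ℝ × ℝ)) (ca cb : ℝ), Removal a (l.map Prod.fst) ca ∧
      Removal b (l.map Prod.snd) cb ∧ (l.map fun z => |z.1 - z.2|).sum + ca + cb = A.cost := by
  have hinj : ∀ p ∈ A.M, ∀ q ∈ A.M, p.1 = q.1 → p = q := by
    intro p hp q hq h
    by_contra hne
    have h1 := A.exactly_one_left p.1
    have : 1 < (A.M.filter (fun p' => p'.1 = p.1)).card :=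
      Finset.one_lt_card.2 ⟨p, by simp [hp], q, by simp [hq, h], hne⟩
    omega
  -- Sorting by the first index also sorts by the second, by order preservation; one list thus lists
  -- the survivors of both series.
  set l := A.M.toList.insertionSort (fun p q => p.1 ≤ q.1) with hl
  have hperm : l.Perm A.M.toList := List.perm_insertionSort _ _
  have hmem : ∀ p, p ∈ l ↔ p ∈ A.M := fun p => by rw [hperm.mem_iff, Finset.mem_toList]
  have hnd : l.Nodup := hperm.nodup_iff.2 A.M.nodup_toList
  have hle : l.Pairwise (fun p q => p.1 ≤ q.1) := by
    have : Std.Total (fun p q : Fin a.length × Fin b.length => p.1 ≤ q.1) :=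
      ⟨fun p q => le_total _ _⟩
    have : IsTrans _ (fun p q : Fin a.length × Fin b.length => p.1 ≤ q.1) :=
      ⟨fun p q r => le_trans⟩
    exact List.pairwise_insertionSort _ _
  have hlt : l.Pairwise (fun p q => p.1 < q.1) :=
    (List.Pairwise.and hle hnd).imp_of_mem fun {p q} hp hq h =>
      lt_of_le_of_ne h.1 fun he => h.2 (hinj p ((hmem p).1 hp) q ((hmem q).1 hq) he)
  have hlt' : l.Pairwise (fun p q => p.2 < q.2) :=
    hlt.imp_of_mem fun {p q} hp hq h => A.ordered p ((hmem p).1 hp) q ((hmem q).1 hq) h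
  have ha := removal_of_pairs a A.M Prod.fst A.Ra A.consecutive_left
    (fun i => by convert A.exactly_one_left i) l hmem hlt
  have hb := removal_of_pairs b A.M Prod.snd A.Rb A.consecutive_right
    (fun i => by convert A.exactly_one_right i) l hmem hlt'
  refine ⟨l.map fun p => (a.get p.1, b.get p.2), _, _, by rw [List.map_map]; exact ha,
    by rw [List.map_map]; exact hb, ?_⟩
  unfold Alignment.cost
  congr 2
  rw [List.map_map, (hperm.map _).sum_eq, Finset.sum_map_toList]
  rfl

/-! ### Existence of alignments -/

/-- The pairs `(1, 2)`, `(3, 4)`, .... -/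
def oddPairs (n : ℕ) : Finset (Fin n × Fin n) :=
  Finset.univ.filter fun p => p.1.val + 1 = p.2.val ∧ Odd p.1.val

lemma card_oddPairs_filter {n : ℕ} (hn : Odd n) (i : Fin n) :
    ((oddPairs n).filter (fun p => p.1 = i ∨ p.2 = i)).card = if i.val = 0 then 0 else 1 := by
  split_ifs with h
  · rw [Finset.card_eq_zero, Finset.filter_eq_empty_iff]
    intro p hp
    simp only [oddPairs, Finset.mem_filter, Finset.mem_univ, true_and] at hp
    rintro (rfl | rfl)
    · rw [h] at hp; exact absurd hp.2 (by decide)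
    · omega
  · rw [Finset.card_eq_one]
    rcases Nat.even_or_odd i.val with he | ho
    · refine ⟨(⟨i.val - 1, by omega⟩, i), ?_⟩
      ext ⟨p, q⟩
      simp only [oddPairs, Finset.mem_filter, Finset.mem_univ, true_and, Finset.mem_singleton,
        Prod.mk.injEq, Fin.ext_iff]
      rw [Nat.even_iff] at he
      rw [Nat.odd_iff]
      omega
    · have hi : i.val + 1 < n := by
        rw [Nat.odd_iff] at hn ho; omega
      refine ⟨(i, ⟨i.val + 1, hi⟩), ?_⟩
      ext ⟨p, q⟩
      simp only [oddPairs, Finset.mem_filter, Finset.mem_univ, true_and, Finset.mem_singleton,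
        Prod.mk.injEq, Fin.ext_iff]
      rw [Nat.odd_iff] at ho ⊢
      omega

lemma card_oddPairs_unmatched {n : ℕ} (hn : Odd n) :
    (Finset.univ.filter (fun i : Fin n => ∀ p ∈ oddPairs n, p.1 ≠ i ∧ p.2 ≠ i)).card = 1 := by
  rw [Finset.card_eq_one]
  refine ⟨⟨0, hn.pos⟩, ?_⟩
  ext i
  have h := card_oddPairs_filter hn i
  simp only [Finset.mem_filter, Finset.mem_univ, true_and, Finset.mem_singleton]
  have h2 : (∀ p ∈ oddPairs n, p.1 ≠ i ∧ p.2 ≠ i) ↔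
      ((oddPairs n).filter (fun p => p.1 = i ∨ p.2 = i)).card = 0 := by
    rw [Finset.card_eq_zero, Finset.filter_eq_empty_iff]
    simp only [not_or, ne_eq]
  rw [h2, h]
  split_ifs with h0 <;> simp [h0, Fin.ext_iff]

/-- The first samples are matched and the others removed in pairs. This keeps `dope` from being the
default infimum `0` of the empty set. -/
lemma nonempty_alignment {a b : List ℝ} (ha : Odd a.length) (hb : Odd b.length) :
    Nonempty (Alignment a b) := by
  refine ⟨⟨{(⟨0, ha.pos⟩, ⟨0, hb.pos⟩)}, oddPairs a.length, oddPairs b.length, ?_, ?_, ?_, ?_, ?_,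
    ?_, ?_⟩⟩
  · intro p hp q hq h
    rw [Finset.mem_singleton] at hp hq
    subst hp hq
    exact absurd h (lt_irrefl _)
  · intro p hp; exact (Finset.mem_filter.1 hp).2.1
  · intro p hp; exact (Finset.mem_filter.1 hp).2.1
  · intro i
    rw [card_oddPairs_filter ha, Finset.filter_singleton]
    by_cases h : i.val = 0
    · simp [h, Fin.ext_iff]
    · simp [h, Fin.ext_iff, Ne.symm h]
  · intro i
    rw [card_oddPairs_filter hb, Finset.filter_singleton]
    by_cases h : i.val = 0
    · simp [h, Fin.ext_iff]
    · simp [h, Fin.ext_iff, Ne.symm h]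
  · rw [card_oddPairs_unmatched ha]; simp
  · rw [card_oddPairs_unmatched hb]; simp

/-! ### The critical series alternates -/

lemma isLocMin_iff (x : List ℝ) {k : ℕ} (hk : k < x.length) : IsLocMin x ⟨k, hk⟩ ↔
    (1 ≤ k → x.getD k 0 < x.getD (k - 1) 0) ∧
      (k + 1 < x.length → x.getD k 0 < x.getD (k + 1) 0) := by
  constructor
  · intro h
    refine ⟨fun h1 => ?_, fun h1 => ?_⟩
    · have := h ⟨k - 1, by omega⟩ (Or.inr (by simp; omega))
      simpa only [← getD_eq_get] using this
    · have := h ⟨k + 1, h1⟩ (Or.inl rfl)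
      simpa only [← getD_eq_get] using this
  · rintro ⟨h1, h2⟩ ⟨j, hj⟩ (h | h)
    · simp only at h
      subst h
      simpa only [← getD_eq_get] using h2 hj
    · simp only at h
      subst h
      simpa only [← getD_eq_get, Nat.add_sub_cancel] using h1 (by omega)

lemma isLocMax_iff (x : List ℝ) {k : ℕ} (hk : k < x.length) : IsLocMax x ⟨k, hk⟩ ↔
    1 ≤ k ∧ k + 1 < x.length ∧ x.getD (k - 1) 0 < x.getD k 0 ∧ x.getD (k + 1) 0 < x.getD k 0 := by
  constructor
  · rintro ⟨h0, h1, h⟩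
    simp only at h0 h1
    refine ⟨h0, h1, ?_, ?_⟩
    · have := h ⟨k - 1, by omega⟩ (Or.inr (by simp; omega))
      simpa only [← getD_eq_get] using this
    · have := h ⟨k + 1, h1⟩ (Or.inl rfl)
      simpa only [← getD_eq_get] using this
  · rintro ⟨h0, h1, h2, h3⟩
    refine ⟨h0, h1, ?_⟩
    rintro ⟨j, hj⟩ (h | h)
    · simp only at h
      subst h
      simpa only [← getD_eq_get] using h3
    · simp only at h
      subst h
      simpa only [← getD_eq_get, Nat.add_sub_cancel] using h2

lemma NoFlatExtremum.getD {x : List ℝ} (hx : NoFlatExtremum x) {i j : ℕ} (hij : i < j)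
    (hj : j < x.length) (hc : ∀ k, i ≤ k → k ≤ j → x.getD k 0 = x.getD i 0) :
    ¬ ((1 ≤ i → x.getD i 0 < x.getD (i - 1) 0) ∧
        (j + 1 < x.length → x.getD j 0 < x.getD (j + 1) 0)) ∧
    ¬ (1 ≤ i ∧ j + 1 < x.length ∧ x.getD (i - 1) 0 < x.getD i 0 ∧
        x.getD (j + 1) 0 < x.getD j 0) := by
  obtain ⟨h1, h2⟩ := hx ⟨i, hij.trans hj⟩ ⟨j, hj⟩ hij (by
    intro k h1 h2
    simpa only [← getD_eq_get] using hc k h1 h2)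
  constructor
  · rintro ⟨h3, h4⟩
    refine h1 ⟨?_, ?_⟩
    · rintro ⟨k, hk⟩ h
      simp only at h
      subst h
      simpa only [← getD_eq_get, Nat.add_sub_cancel] using h3 (by omega)
    · rintro ⟨k, hk⟩ h
      simp only at h
      subst h
      simpa only [← getD_eq_get] using h4 hk
  · rintro ⟨h3, h4, h5, h6⟩
    refine h2 ⟨⟨i - 1, by omega⟩, ⟨j + 1, h4⟩, by simp; omega, rfl, ?_, ?_⟩
    · simpa only [← getD_eq_get] using h5
    · simpa only [← getD_eq_get] using h6

open Classical in
/-- The critical values of `x` from time `k` on. -/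
def criticalFrom (x : List ℝ) (k : ℕ) : List ℝ :=
  ((List.range' k (x.length - k)).filter
    (fun i => decide (∃ h : i < x.length, IsCritical x ⟨i, h⟩))).map (x.getD · 0)

lemma criticalFrom_zero (x : List ℝ) : criticalFrom x 0 = criticalSeries x := by
  classical
  unfold criticalFrom criticalSeries
  rw [Nat.sub_zero, ← List.range_eq_range', ← List.map_coe_finRange_eq_range, List.filter_map,
    List.map_map]
  simp [Function.comp_def]

lemma criticalFrom_length (x : List ℝ) : criticalFrom x x.length = [] := by
  simp [criticalFrom]

lemma criticalFrom_of_critical {x : List ℝ} {k : ℕ} (hk : k < x.length)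
    (h : IsCritical x ⟨k, hk⟩) : criticalFrom x k = x.getD k 0 :: criticalFrom x (k + 1) := by
  unfold criticalFrom
  rw [show x.length - k = (x.length - (k + 1)) + 1 by omega, List.range'_succ,
    List.filter_cons_of_pos (by simpa using ⟨hk, h⟩), List.map_cons]

lemma criticalFrom_of_not_critical {x : List ℝ} {k : ℕ} (hk : k < x.length)
    (h : ¬ IsCritical x ⟨k, hk⟩) : criticalFrom x k = criticalFrom x (k + 1) := by
  unfold criticalFrom
  rw [show x.length - k = (x.length - (k + 1)) + 1 by omega, List.range'_succ,
    List.filter_cons_of_neg (by simpa using fun _ => h)]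

lemma Zigzag.mono_false {a a' : ℝ} {l : List ℝ} (h : Zigzag false (a :: l)) (ha : a ≤ a') :
    Zigzag false (a' :: l) := by
  cases l with
  | nil => trivial
  | cons b l => exact ⟨le_trans (by simpa using h.1) ha, h.2⟩

lemma Zigzag.mono_true {a a' : ℝ} {l : List ℝ} (h : Zigzag true (a :: l)) (ha : a' ≤ a) :
    Zigzag true (a' :: l) := by
  cases l with
  | nil => trivial
  | cons b l => exact ⟨ha.trans (by simpa using h.1), h.2⟩

/-- The induction runs along the series with two states: the plateau `i, …, k` was entered by a
descent (or starts the series), or by an ascent. In the first state the remaining critical values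
begin with a minimum and are odd in number; in the second any that remain begin with a maximum, and
their number is even. -/
lemma criticalFrom_zigzag {x : List ℝ} (hx : NoFlatExtremum x) {B : ℝ} (hB : ∀ y ∈ x, y ≤ B) :
    ∀ (d k : ℕ), k + 1 + d = x.length →
    ((∃ i ≤ k, (∀ m, i ≤ m → m ≤ k → x.getD m 0 = x.getD i 0) ∧
        (1 ≤ i → x.getD i 0 < x.getD (i - 1) 0)) →
      Zigzag false (x.getD k 0 :: (criticalFrom x k ++ [B])) ∧ Odd (criticalFrom x k).length) ∧
    ((∃ i ≤ k, (∀ m, i ≤ m → m ≤ k → x.getD m 0 = x.getD i 0) ∧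
        1 ≤ i ∧ x.getD (i - 1) 0 < x.getD i 0) →
      Zigzag true (x.getD k 0 :: (criticalFrom x k ++ [B])) ∧
        Even (criticalFrom x k).length) := by
  intro d k hd
  have hk : k < x.length := by omega
  have hkB : x.getD k 0 ≤ B := hB _ (by
    rw [getD_eq_get x ⟨k, hk⟩]; exact List.get_mem _ _)
  constructor
  · rintro ⟨i, hik, hc, hi⟩
    have hprev : 1 ≤ k → x.getD k 0 ≤ x.getD (k - 1) 0 := by
      intro h1
      rcases eq_or_lt_of_le hik with rfl | hlt
      · exact (hi h1).le
      · rw [hc k hik le_rfl, hc (k - 1) (by omega) (by omega)]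
    have hmax : ¬ IsLocMax x ⟨k, hk⟩ := by
      rw [isLocMax_iff]
      rintro ⟨h1, -, h2, -⟩
      exact absurd h2 (not_lt.2 (hprev h1))
    -- A turn at `k` forces the plateau to be a single sample, as it would otherwise be a flat
    -- minimum.
    have hmin : (k + 1 < x.length → x.getD k 0 < x.getD (k + 1) 0) → IsLocMin x ⟨k, hk⟩ := by
      intro h
      have : i = k := by
        by_contra hne
        exact (hx.getD (lt_of_le_of_ne hik hne) hk hc).1 ⟨hi, h⟩
      subst this
      exact (isLocMin_iff x hk).2 ⟨hi, h⟩
    cases d with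
    | zero =>
      rw [criticalFrom_of_critical hk (Or.inl (hmin (by omega))),
        show k + 1 = x.length by omega, criticalFrom_length]
      simpa [Zigzag] using hkB
    | succ d =>
      obtain ⟨ih1, ih2⟩ := criticalFrom_zigzag hx hB d (k + 1) (by omega)
      rcases lt_trichotomy (x.getD k 0) (x.getD (k + 1) 0) with h | h | h
      · rw [criticalFrom_of_critical hk (Or.inl (hmin fun _ => h))]
        obtain ⟨h1, h2⟩ := ih2 ⟨k + 1, le_rfl, fun m h1 h2 => by rw [le_antisymm h2 h1],
          by omega, by simpa using h⟩
        exact ⟨⟨by simp, h1.mono_true h.le⟩, by simpa using h2.add_one⟩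
      · rw [criticalFrom_of_not_critical hk (by
          rintro (h1 | h1)
          · exact absurd (((isLocMin_iff x hk).1 h1).2 (by omega)) (by rw [h]; exact lt_irrefl _)
          · exact hmax h1), h]
        refine ih1 ⟨i, by omega, fun m h1 h2 => ?_, hi⟩
        rcases eq_or_lt_of_le h2 with rfl | h3
        · rw [← h, hc k hik le_rfl]
        · exact hc m h1 (by omega)
      · rw [criticalFrom_of_not_critical hk (by
          rintro (h1 | h1)
          · exact absurd (((isLocMin_iff x hk).1 h1).2 (by omega)) (not_lt.2 h.le)
          · exact hmax h1)]
        obtain ⟨h1, h2⟩ := ih1 ⟨k + 1, le_rfl, fun m h1 h2 => by rw [le_antisymm h2 h1],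
          fun _ => by simpa using h⟩
        exact ⟨h1.mono_false h.le, h2⟩
  · rintro ⟨i, hik, hc, h0, hi⟩
    have hprev : x.getD (k - 1) 0 ≤ x.getD k 0 := by
      rcases eq_or_lt_of_le hik with rfl | hlt
      · exact hi.le
      · rw [hc k hik le_rfl, hc (k - 1) (by omega) (by omega)]
    have hmin : ¬ IsLocMin x ⟨k, hk⟩ := by
      rw [isLocMin_iff]
      rintro ⟨h1, -⟩
      exact absurd (h1 (by omega)) (not_lt.2 hprev)
    cases d with
    | zero =>
      -- An endpoint reached by an ascent is not critical, so only the step up to `B` remains.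
      rw [criticalFrom_of_not_critical hk (by
          rintro (h1 | h1)
          · exact hmin h1
          · have := ((isLocMax_iff x hk).1 h1).2.1
            omega), show k + 1 = x.length by omega, criticalFrom_length]
      simpa [Zigzag] using hkB
    | succ d =>
      obtain ⟨ih1, ih2⟩ := criticalFrom_zigzag hx hB d (k + 1) (by omega)
      rcases lt_trichotomy (x.getD k 0) (x.getD (k + 1) 0) with h | h | h
      · rw [criticalFrom_of_not_critical hk (by
          rintro (h1 | h1)
          · exact hmin h1
          · exact absurd ((isLocMax_iff x hk).1 h1).2.2.2 (not_lt.2 h.le))]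
        obtain ⟨h1, h2⟩ := ih2 ⟨k + 1, le_rfl, fun m h1 h2 => by rw [le_antisymm h2 h1],
          by omega, by simpa using h⟩
        exact ⟨h1.mono_true h.le, h2⟩
      · rw [criticalFrom_of_not_critical hk (by
          rintro (h1 | h1)
          · exact hmin h1
          · exact absurd ((isLocMax_iff x hk).1 h1).2.2.2 (by rw [h]; exact lt_irrefl _)), h]
        refine ih2 ⟨i, by omega, fun m h1 h2 => ?_, h0, hi⟩
        rcases eq_or_lt_of_le h2 with rfl | h3
        · rw [← h, hc k hik le_rfl]
        · exact hc m h1 (by omega)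
      · have hik' : i = k := by
          by_contra hne
          exact (hx.getD (lt_of_le_of_ne hik hne) hk hc).2 ⟨h0, by omega, hi, h⟩
        subst hik'
        rw [criticalFrom_of_critical hk (Or.inr ((isLocMax_iff x hk).2 ⟨h0, by omega, hi, h⟩))]
        obtain ⟨h1, h2⟩ := ih1 ⟨i + 1, le_rfl, fun m h1 h2 => by rw [le_antisymm h2 h1],
          fun _ => by simpa using h⟩
        exact ⟨⟨by simp, h1.mono_false h.le⟩, by simpa using h2.add_one⟩

lemma criticalSeries_zigzag {x : List ℝ} (h0 : x ≠ []) (hx : NoFlatExtremum x) {B : ℝ}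
    (hB : ∀ y ∈ x, y ≤ B) :
    Zigzag false (B :: (criticalSeries x ++ [B])) ∧ Odd (criticalSeries x).length := by
  have hpos := List.length_pos_iff.2 h0
  obtain ⟨h1, h2⟩ := (criticalFrom_zigzag hx hB (x.length - 1) 0 (by omega)).1
    ⟨0, le_rfl, fun m _ hm => by rw [Nat.le_zero.1 hm], fun h => by omega⟩
  rw [criticalFrom_zero] at h1 h2
  exact ⟨h1.mono_false (hB _ (by rw [getD_eq_get x ⟨0, hpos⟩]; exact List.get_mem _ _)), h2⟩

lemma mem_of_mem_criticalSeries {x : List ℝ} {y : ℝ} (hy : y ∈ criticalSeries x) : y ∈ x := by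
  unfold criticalSeries at hy
  obtain ⟨i, -, rfl⟩ := List.mem_map.1 hy
  exact List.get_mem _ _

end TimeSeries

end

theorem mainTheorem2 (x y : List ℝ) (hx : x ≠ []) (hy : y ≠ [])
    (hx_flat : TimeSeries.NoFlatExtremum x) (hy_flat : TimeSeries.NoFlatExtremum y)
    (q : ENNReal) [Fact (1 ≤ q)] :
    TimeSeries.wasserstein1 q
        (TimeSeries.diagram (TimeSeries.criticalSeries x))
        (TimeSeries.diagram (TimeSeries.criticalSeries y)) ≤
      ENNReal.ofReal (TimeSeries.dope x y) := by
  obtain ⟨B, hB⟩ := (x ++ y).toFinset.bddAbove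
  have hxB : ∀ z ∈ x, z ≤ B := fun z hz => hB (by simp [hz])
  have hyB : ∀ z ∈ y, z ≤ B := fun z hz => hB (by simp [hz])
  obtain ⟨hzx, hox⟩ := TimeSeries.criticalSeries_zigzag hx hx_flat hxB
  obtain ⟨hzy, hoy⟩ := TimeSeries.criticalSeries_zigzag hy hy_flat hyB
  have hle : ∀ A : TimeSeries.Alignment (TimeSeries.criticalSeries x)
      (TimeSeries.criticalSeries y), TimeSeries.wasserstein1 q
        (TimeSeries.diagram (TimeSeries.criticalSeries x))
        (TimeSeries.diagram (TimeSeries.criticalSeries y)) ≤ ENNReal.ofReal A.cost := by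
    intro A
    obtain ⟨l, ca, cb, ha, hb, hc⟩ := A.exists_removal
    rw [← hc]
    exact (TimeSeries.close_of_removal l (List.length_pos_iff.1 hox.pos)
      (List.length_pos_iff.1 hoy.pos) (fun z hz => hxB z (TimeSeries.mem_of_mem_criticalSeries hz))
      (fun z hz => hyB z (TimeSeries.mem_of_mem_criticalSeries hz)) hzx hzy ha hb).wasserstein1_le q
  -- One alignment makes the distance finite, so the comparison with the infimum of costs can take
  -- place in `ℝ`.
  obtain ⟨A₀⟩ := TimeSeries.nonempty_alignment hox hoy
  have hfin := ne_top_of_le_ne_top ENNReal.ofReal_ne_top (hle A₀)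
  rw [← ENNReal.ofReal_toReal hfin]
  refine ENNReal.ofReal_le_ofReal (le_csInf ⟨_, A₀, rfl⟩ ?_)
  rintro c ⟨A, rfl⟩
  refine ENNReal.toReal_le_of_le_ofReal ?_ (hle A)
  unfold TimeSeries.Alignment.cost
  positivity
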